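/- Let $d\ge 4$ be an integer, $p\ge 3$ an odd integer, $k:=d-1$, $\ell:=1+\frac4{p-1}$, and let $\beta>1$ satisfy $k>\beta(\ell+\sqrt\ell)$. Write $(t,x)\in\mathbb R^{1+d}$, $\partial^\alpha f\partial_\alpha g:=-\partial_tf\,\partial_tg+\nabla_xf\cdot\nabla_xg$, $\Box:=-\partial_t^2+\Delta$, and let $D^jf$ be the collection of all partial derivatives of $f$ of order $j$ in $(t,x)$, with $D_xf=\nabla_xf$. Let $C^\infty_{\mathrm e}$ (resp. $C^\infty_{\mathrm o}$) be the set of $f\in C^\infty([0,\infty))$ of the form $f(Z)=\tilde f(Z^2)$ (resp. $f(Z)=Z\tilde f(Z^2)$) with $\tilde f\in C^\infty([0,\infty))$. Let $v\in C_{\mathrm o}^\infty$ with values in $(-1,1)$ and $v(0)=0$ solve on $[0,\infty)$ $$Z\big[(1-Zv)^2-\ell(v-Z)^2\big]\frac{dv}{dZ}=(1-v^2)\big[\beta\ell(1-v^2)Z-kv(1-Zv)\big].$$ Set $$\hat\phi_0(Z)=\tfrac1{\beta-1}\exp\Big((\beta-1)\int_0^Z\tfrac{v(s)}{1-sv(s)}ds\Big),\qquad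 \hat\rho_0(Z)=\frac{(\beta-1)^{\frac2{p-1}}\hat\phi_0(Z)^{\frac2{p-1}}(1-v(Z)^2)^{\frac1{p-1}}}{(1-Zv(Z))^{\frac2{p-1}}},$$ and, with $T=1$ and $Z=|x|/(1-t)$, $\phi_0(t,x)=(1-t)^{1-\beta}\hat\phi_0(Z)$, $\rho_0(t,x)=(1-t)^{-\frac{2\beta}{p-1}}\hat\rho_0(Z)$. For $\lambda\in\mathbb R$ let $\mathscr X_\lambda$ be the set of real functions on $\{t<1\}\subset\mathbb R^{1+d}$ of the form $(1-t)^\lambda\sum_{j=0}^{m}f_j(Z)\tau^j$ with $m\ge0$, $f_j\in C^\infty_{\mathrm e}$, $\tau=-\ln(1-t)$. For $n\ge1$ let $\rho_n\in\mathscr X_{\mu_n}$ and $\phi_n\in\mathscr X_{\lambda_n}$, where $\mu_n=2n(\beta-1)-\frac{2\beta}{p-1}$ and $\lambda_n=(2n-1)(\beta-1)$, be such that on $[0,1)\times\mathbb R^d$, for every $n\ge1$, $$\Box\rho_{n-1}=\sum_{n_1+\cdots+n_p=n}\rho_{n_1}\cdots\rho_{n_p}+\sum_{n_1+n_2+n_3=n}\rho_{n_1}\partial^\alpha\phi_{n_2}\partial_\alpha\phi_{n_3},\qquad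 0=2\sum_{n_1+n_2=n}\partial^\alpha\rho_{n_1}\partial_\alpha\phi_{n_2}+\sum_{n_1+n_2=n}\rho_{n_1}\Box\phi_{n_2}.$$ Let $\eta\in C_c^\infty(\mathbb R;[0,1])$ with $\eta=1$ on $[0,1]$ and $\eta=0$ on $[2,\infty)$, and let $\mathcal C=\{(t,x)\in[0,1)\times\mathbb R^d:|x|<2(1-t)\}$. Then there exist an integer $N_0\ge1$, $c_0\in(0,1)$ and a sequence $(T_n)_{n\ge0}$ with $T_n=1$ for $0\le n<N_0$ and $0<T_n\le T_{n-1}/4$ for $n\ge N_0$, such that the sums $$\rho_*=\sum_{n\ge0}\eta\Big(\frac{1-t}{T_n}\Big)\rho_n,\qquad \phi_*=\sum_{n\ge0}\eta\Big(\frac{1-t}{T_n}\Big)\phi_n$$ are finite at every point with $t<1$ and define smooth functions there, and, with $E_*=\rho_*^p+\rho_*\partial^\alpha\phi_*\partial_\alpha\phi_*-\Box\rho_*$ and $J_*=2\partial^\alpha\rho_*\partial_\alpha\phi_*+\rho_*\Box\phi_*$: 1. for all integers $j\ge0$: $(1-t)^{\beta+j-1}D^j\phi_*\in L^\infty(\mathcal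 C)$ and $(1-t)^{\frac{2\beta}{p-1}+j}D^j\rho_*\in L^\infty(\mathcal C)$; 2. for all $(t,x)\in\mathcal C$ with $1-t<c_0$: $(1-t)^\beta(\partial_t\phi_*-|D_x\phi_*|)\ge c_0$ and $(1-t)^{\frac{2\beta}{p-1}}\rho_*\ge c_0$; 3. for all $\lambda>0$ and all integers $j\ge0$: $(1-t)^{-\lambda}D^jE_*\in L^\infty(\mathcal C)$ and $(1-t)^{-\lambda}D^jJ_*\in L^\infty(\mathcal C)$. -/

import Mathlib

open Set
open scoped ContDiff

noncomputable section

namespace ImplodingWave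

/-- Spacetime `ℝ^{1+d}`, with points `(t, x)`. Only the norm of the factor `ℝ^d` (which is the
Euclidean one) is ever used in an exact estimate. -/
abbrev Spacetime (d : ℕ) : Type := ℝ × EuclideanSpace ℝ (Fin d)

variable {d : ℕ}

/-! ### Differential operators on Minkowski spacetime of signature `(-, +, …, +)` -/

/-- `∂_t f`. -/
def dt (f : Spacetime d → ℝ) (z : Spacetime d) : ℝ := fderiv ℝ f z (1, 0)

/-- `∂_i f`, for a spatial index `i`. -/
def dx (i : Fin d) (f : Spacetime d → ℝ) (z : Spacetime d) : ℝ :=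
  fderiv ℝ f z (0, EuclideanSpace.single i 1)

/-- `|D_x f|`, the Euclidean length of the spatial gradient. -/
def normDx (f : Spacetime d → ℝ) (z : Spacetime d) : ℝ := √(∑ i, dx i f z ^ 2)

/-- `∂^α f ∂_α g`. -/
def mink (f g : Spacetime d → ℝ) (z : Spacetime d) : ℝ :=
  -(dt f z * dt g z) + ∑ i, dx i f z * dx i g z

/-- The d'Alembertian `□ f = -∂_t² f + Δ f`. -/
def box (f : Spacetime d → ℝ) (z : Spacetime d) : ℝ :=
  -dt (dt f) z + ∑ i, dx i (dx i f) z

/-! ### Even and odd smooth functions on `[0, ∞)` -/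

/-- `C_e^∞([0,∞))`: smooth `f` with `f(Z) = g(Z²)` for a smooth `g` on `[0,∞)`. -/
def EvenSmooth (f : ℝ → ℝ) : Prop :=
  ContDiffOn ℝ ∞ f (Ici 0) ∧
    ∃ g : ℝ → ℝ, ContDiffOn ℝ ∞ g (Ici 0) ∧ ∀ Z, 0 ≤ Z → f Z = g (Z ^ 2)

/-- `C_o^∞([0,∞))`: smooth `f` with `f(Z) = Z g(Z²)` for a smooth `g` on `[0,∞)`. -/
def OddSmooth (f : ℝ → ℝ) : Prop :=
  ContDiffOn ℝ ∞ f (Ici 0) ∧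
    ∃ g : ℝ → ℝ, ContDiffOn ℝ ∞ g (Ici 0) ∧ ∀ Z, 0 ≤ Z → f Z = Z * g (Z ^ 2)

/-! ### The leading order self-similar profile -/

/-- `ℓ = 1 + 4 / (p - 1)`. -/
def ell (p : ℕ) : ℝ := 1 + 4 / ((p : ℝ) - 1)

/-- `Δ_Z(Z, v)`. -/
def DeltaZ (ℓ Z v : ℝ) : ℝ := Z * ((1 - Z * v) ^ 2 - ℓ * (v - Z) ^ 2)

/-- `Δ_v(Z, v)`. -/
def DeltaV (k ℓ β Z v : ℝ) : ℝ :=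
  (1 - v ^ 2) * (β * ℓ * (1 - v ^ 2) * Z - k * v * (1 - Z * v))

/-- `v : [0,∞) → (-1,1)` is an odd smooth solution of `Δ_Z(Z,v) v' = Δ_v(Z,v)` with `v(0) = 0`. -/
def IsProfile (k ℓ β : ℝ) (v : ℝ → ℝ) : Prop :=
  OddSmooth v ∧ v 0 = 0 ∧ ∀ Z, 0 ≤ Z →
    v Z ∈ Ioo (-1 : ℝ) 1 ∧
      DeltaZ ℓ Z (v Z) * derivWithin v (Ici 0) Z = DeltaV k ℓ β Z (v Z)

/-- `φ̂₀(Z)`. -/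
def phiHat (β : ℝ) (v : ℝ → ℝ) (Z : ℝ) : ℝ :=
  1 / (β - 1) * Real.exp ((β - 1) * ∫ s in (0 : ℝ)..Z, v s / (1 - s * v s))

/-- `ρ̂₀(Z)`. -/
def rhoHat (p : ℕ) (β : ℝ) (v : ℝ → ℝ) (Z : ℝ) : ℝ :=
  (β - 1) ^ (2 / ((p : ℝ) - 1)) * phiHat β v Z ^ (2 / ((p : ℝ) - 1)) *
      (1 - v Z ^ 2) ^ (1 / ((p : ℝ) - 1)) /
    (1 - Z * v Z) ^ (2 / ((p : ℝ) - 1))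

/-- `φ₀(t,x) = (1-t)^{1-β} φ̂₀(|x|/(1-t))` (blow-up time `T = 1`). -/
def phiZero (β : ℝ) (v : ℝ → ℝ) (z : Spacetime d) : ℝ :=
  (1 - z.1) ^ (1 - β) * phiHat β v (‖z.2‖ / (1 - z.1))

/-- `ρ₀(t,x) = (1-t)^{-2β/(p-1)} ρ̂₀(|x|/(1-t))` (blow-up time `T = 1`). -/
def rhoZero (p : ℕ) (β : ℝ) (v : ℝ → ℝ) (z : Spacetime d) : ℝ :=
  (1 - z.1) ^ (-(2 * β / ((p : ℝ) - 1))) * rhoHat p β v (‖z.2‖ / (1 - z.1))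

/-! ### The function spaces and the formal expansion -/

/-- The real-valued members of `𝒳_λ = (1-t)^λ 𝒳_0`: the functions
`(1-t)^λ ∑_{j ≤ n} f_j(Z) τ^j` with `f_j ∈ C_e^∞([0,∞))`, `Z = |x|/(1-t)`, `τ = -ln(1-t)`.
The formula on `0 ≤ t < 1` determines the coefficients `f_j`; it is imposed for all `t < 1`, so that
the time derivatives at `t = 0` can be taken as ordinary (two-sided) ones. Nothing is required for
`t ≥ 1`. -/
def SpaceX (d : ℕ) (lam : ℝ) : Set (Spacetime d → ℝ) :=
  {f | ∃ (n : ℕ) (a : ℕ → ℝ → ℝ), (∀ j, j ≤ n → EvenSmooth (a j)) ∧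
    ∀ z : Spacetime d, z.1 < 1 →
      f z = (1 - z.1) ^ lam *
        ∑ j ∈ Finset.range (n + 1), a j (‖z.2‖ / (1 - z.1)) * (-Real.log (1 - z.1)) ^ j}

/-- `λ_n = (2n-1)(β-1)`. -/
def lamExp (β : ℝ) (n : ℕ) : ℝ := (2 * (n : ℝ) - 1) * (β - 1)

/-- `μ_n = 2n(β-1) - 2β/(p-1)`. -/
def muExp (p : ℕ) (β : ℝ) (n : ℕ) : ℝ := 2 * (n : ℝ) * (β - 1) - 2 * β / ((p : ℝ) - 1)

/-- The coefficient of `b^n` (`n ≥ 1`) in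
`b □ρ = ρ^p + ρ ∂^αφ ∂_αφ`, `2 ∂^αρ ∂_αφ + ρ □φ = 0` for `ρ = ∑ ρ_n b^n`, `φ = ∑ φ_n b^n`,
at the point `z`. -/
def RecurrenceAt (p : ℕ) (ρ φ : ℕ → Spacetime d → ℝ) (n : ℕ) (z : Spacetime d) : Prop :=
  box (ρ (n - 1)) z =
      (∑ m ∈ Finset.Nat.antidiagonalTuple p n, ∏ i, ρ (m i) z) +
        ∑ m ∈ Finset.Nat.antidiagonalTuple 3 n, ρ (m 0) z * mink (φ (m 1)) (φ (m 2)) z ∧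
    0 = 2 * (∑ m ∈ Finset.HasAntidiagonal.antidiagonal n, mink (ρ m.1) (φ m.2) z) +
        ∑ m ∈ Finset.HasAntidiagonal.antidiagonal n, ρ m.1 z * box (φ m.2) z

/-- `(ρ_n, φ_n)_{n ≥ 0}` is a self-similar formal solution on `[0,1) × ℝ^d` issued from the leading
order term `(ρ₀, φ₀)` given by the profile `v`. -/
def IsFormalSolution (p : ℕ) (β : ℝ) (v : ℝ → ℝ) (ρ φ : ℕ → Spacetime d → ℝ) : Prop :=
  (∀ z : Spacetime d, z.1 < 1 → ρ 0 z = rhoZero p β v z ∧ φ 0 z = phiZero β v z) ∧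
    ∀ n : ℕ, 1 ≤ n →
      ρ n ∈ SpaceX d (muExp p β n) ∧ φ n ∈ SpaceX d (lamExp β n) ∧
        ∀ z : Spacetime d, 0 ≤ z.1 → z.1 < 1 → RecurrenceAt p ρ φ n z

/-! ### The truncated series and its error -/

/-- `η ∈ C_c^∞(ℝ; [0,1])`, `η = 1` on `[0,1]`, `η = 0` on `[2,∞)`. -/
def IsBump (η : ℝ → ℝ) : Prop :=
  ContDiff ℝ ∞ η ∧ HasCompactSupport η ∧ (∀ s, η s ∈ Icc (0 : ℝ) 1) ∧
    (∀ s ∈ Icc (0 : ℝ) 1, η s = 1) ∧ ∀ s, 2 ≤ s → η s = 0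

/-- `∑_n η((1-t)/T_n) f_n(t,x)` (with `b = 1`). -/
def truncSum (η : ℝ → ℝ) (T : ℕ → ℝ) (f : ℕ → Spacetime d → ℝ) (z : Spacetime d) : ℝ :=
  ∑' n, η ((1 - z.1) / T n) * f n z

/-- `E = ρ^p + ρ ∂^αφ ∂_αφ - □ρ` (with `b = 1`). -/
def errE (p : ℕ) (ρ φ : Spacetime d → ℝ) (z : Spacetime d) : ℝ :=
  ρ z ^ p + ρ z * mink φ φ z - box ρ z

/-- `J = 2 ∂^αρ ∂_αφ + ρ □φ`. -/
def errJ (ρ φ : Spacetime d → ℝ) (z : Spacetime d) : ℝ :=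
  2 * mink ρ φ z + ρ z * box φ z

/-- The cone `𝒞 = {(t,x) ∈ [0,1) × ℝ^d : |x| < 2(1-t)}`. -/
def cone (d : ℕ) : Set (Spacetime d) :=
  {z | 0 ≤ z.1 ∧ z.1 < 1 ∧ ‖z.2‖ < 2 * (1 - z.1)}

/-- `(1-t)^a D^j f ∈ L^∞(𝒞)`. All the `f` concerned are smooth on `{t < 1}`, so the essential
supremum is a supremum; `D^j f` is measured by the norm of the `j`-th iterated derivative, which is
equivalent to the Euclidean norm of the vector of all partial derivatives of order `j`. -/
def WeightedBdd (a : ℝ) (j : ℕ) (f : Spacetime d → ℝ) : Prop :=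
  ∃ C : ℝ, ∀ z ∈ cone d, (1 - z.1) ^ a * ‖iteratedFDeriv ℝ j f z‖ ≤ C

end ImplodingWave

end

open ImplodingWave

/-! The proof is a Borel summation at the tip (1, 0) of the cone. Call f a symbol of order a if it
is smooth for t < 1 and D^j f = O((1-t)^{a-j}) on the cone for every j (`IsSymbol`). Products add
orders and each derivative costs one. Functions homogeneous under dilations about the tip are
symbols, because dilations reduce the bounds to the compact set t = 0, |x| ≤ 2
(`IsSymbol.of_homogeneous`). Powers of log(1-t) cost an arbitrarily small order, so members of 𝒳_λ
are symbols of every order below λ (`isSymbol_of_mem_spaceX`). Put δ = β-1 > 0: the orders of φ_n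
and ρ_n then increase by at least δ at each step in n.

The cutoffs η((1-t)/T) are symbols of order 0 uniformly in T, and on their support (1-t)^δ is as
small as desired once T is small. So T_n can be chosen such that the first n derivatives of the n-th
truncated term are at most 2^{-n} times the expected size, at the price of one δ
(`IsSymbol.exists_threshold`). The truncated series then differs from its N-th partial sum by a
symbol whose order grows like Nδ (`isSymbol_truncSum_sub`). The recurrence cancels the low-degree
part of E and J on partial sums, and E and J are polynomial in the functions and their derivatives,
so both errors have arbitrarily high order (`isSymbol_err_of_asymptotic`).

At order zero, writing v(Z) = Z g(Z²) makes everything smooth in w = Z². This needs 1 - Zv > 0,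
which the profile equation forces at a hypothetical first zero (`IsProfile.one_sub_mul_pos`). The
eikonal equation is built into the definition of ρ̂₀ (`leading_order_E`); the continuity equation is
the profile equation in disguise (`leading_order_J`). Finally |v| < 1 says that the gradient of φ₀
is timelike, which with ρ̂₀ > 0 gives the lower bounds for the leading terms; the remaining terms
are smaller by a factor (1-t)^δ. -/

namespace ImplodingWave

/-! ### Symbol calculus in the cone. -/

open Filter Topology

variable {d : ℕ} {F : Type} [NormedAddCommGroup F] [NormedSpace ℝ F]

/-! ### The region `t < 1` -/

/-- The region `{t < 1}` of spacetime. -/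
def past (d : ℕ) : Set (Spacetime d) := {z | z.1 < 1}

lemma isOpen_past : IsOpen (past d) := isOpen_lt continuous_fst continuous_const

lemma past_mem_nhds {z : Spacetime d} (hz : z ∈ past d) : past d ∈ 𝓝 z :=
  isOpen_past.mem_nhds hz

lemma cone_subset_past : cone d ⊆ past d := fun _ hz => hz.2.1

lemma one_sub_pos_of_mem_past {z : Spacetime d} (hz : z ∈ past d) : 0 < 1 - z.1 := sub_pos.2 hz

lemma one_sub_le_one_of_mem_cone {z : Spacetime d} (hz : z ∈ cone d) : 1 - z.1 ≤ 1 := by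
  have := hz.1; linarith

lemma one_sub_pos_of_mem_cone {z : Spacetime d} (hz : z ∈ cone d) : 0 < 1 - z.1 :=
  one_sub_pos_of_mem_past (cone_subset_past hz)

lemma contDiffAt_of_past {f : Spacetime d → F} (hf : ContDiffOn ℝ ∞ f (past d))
    {z : Spacetime d} (hz : z ∈ past d) : ContDiffAt ℝ ∞ f z :=
  hf.contDiffAt (past_mem_nhds hz)

lemma contDiffAt_nat_of_past {f : Spacetime d → F} (hf : ContDiffOn ℝ ∞ f (past d))
    {z : Spacetime d} (hz : z ∈ past d) (j : ℕ) : ContDiffAt ℝ j f z :=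
  (contDiffAt_of_past hf hz).of_le (mod_cast le_top)

lemma differentiableAt_of_past {f : Spacetime d → F} (hf : ContDiffOn ℝ ∞ f (past d))
    {z : Spacetime d} (hz : z ∈ past d) : DifferentiableAt ℝ f z :=
  (contDiffAt_of_past hf hz).differentiableAt (by simp)

lemma continuousOn_iteratedFDeriv_past {f : Spacetime d → F} (hf : ContDiffOn ℝ ∞ f (past d))
    (j : ℕ) : ContinuousOn (iteratedFDeriv ℝ j f) (past d) :=
  (hf.continuousOn_iteratedFDerivWithin (mod_cast le_top) isOpen_past.uniqueDiffOn).congr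
    fun _ hz => (iteratedFDerivWithin_of_isOpen j isOpen_past hz).symm

lemma norm_iteratedFDeriv_mul_le_past {f g : Spacetime d → ℝ} (hf : ContDiffOn ℝ ∞ f (past d))
    (hg : ContDiffOn ℝ ∞ g (past d)) {z : Spacetime d} (hz : z ∈ past d) (j : ℕ) :
    ‖iteratedFDeriv ℝ j (f * g) z‖ ≤ ∑ i ∈ Finset.range (j + 1),
      (j.choose i : ℝ) * ‖iteratedFDeriv ℝ i f z‖ * ‖iteratedFDeriv ℝ (j - i) g z‖ := by
  have h := norm_iteratedFDerivWithin_mul_le hf hg isOpen_past.uniqueDiffOn hz (n := j)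
    (mod_cast le_top)
  simp only [iteratedFDerivWithin_of_isOpen _ isOpen_past hz] at h
  exact h

/-! ### Symbols: weighted bounds on all derivatives in the cone -/

/-- `f` is smooth on `{t < 1}` and `D^j f = O((1-t)^{a-j})` on the cone, for every `j`. -/
def IsSymbol (a : ℝ) (f : Spacetime d → F) : Prop :=
  ContDiffOn ℝ ∞ f (past d) ∧
    ∀ j : ℕ, ∃ C : ℝ, ∀ z ∈ cone d, ‖iteratedFDeriv ℝ j f z‖ ≤ C * (1 - z.1) ^ (a - j)

/-- A Leibniz estimate for products, at a point. -/
lemma norm_iteratedFDeriv_mul_le_rpow {f g : Spacetime d → ℝ} (hf : ContDiffOn ℝ ∞ f (past d))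
    (hg : ContDiffOn ℝ ∞ g (past d)) {z : Spacetime d} (hz : z ∈ past d) {a b : ℝ}
    {A B : ℕ → ℝ} (hA : ∀ i, ‖iteratedFDeriv ℝ i f z‖ ≤ A i * (1 - z.1) ^ (a - i))
    (hB : ∀ i, ‖iteratedFDeriv ℝ i g z‖ ≤ B i * (1 - z.1) ^ (b - i)) (j : ℕ) :
    ‖iteratedFDeriv ℝ j (f * g) z‖ ≤
      (∑ i ∈ Finset.range (j + 1), (j.choose i : ℝ) * A i * B (j - i)) *
        (1 - z.1) ^ (a + b - j) := by
  have hp := one_sub_pos_of_mem_past hz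
  refine (norm_iteratedFDeriv_mul_le_past hf hg hz j).trans ?_
  rw [Finset.sum_mul]
  refine Finset.sum_le_sum fun i hi => ?_
  have hij : i ≤ j := Nat.lt_succ_iff.1 (Finset.mem_range.1 hi)
  have e : (1 - z.1) ^ (a + b - j) = (1 - z.1) ^ (a - i) * (1 - z.1) ^ (b - (j - i : ℕ)) := by
    rw [← Real.rpow_add hp, Nat.cast_sub hij]; ring_nf
  calc _ ≤ (j.choose i : ℝ) * (A i * (1 - z.1) ^ (a - i)) *
        (B (j - i) * (1 - z.1) ^ (b - (j - i : ℕ))) := by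
        gcongr
        · exact mul_nonneg (Nat.cast_nonneg _) ((norm_nonneg _).trans (hA i))
        · exact hA i
        · exact hB _
    _ = _ := by rw [e]; ring

namespace IsSymbol

variable {a b : ℝ}

lemma mono {f : Spacetime d → F} (hf : IsSymbol a f) (h : b ≤ a) : IsSymbol b f := by
  refine ⟨hf.1, fun j => ?_⟩
  obtain ⟨C, hC⟩ := hf.2 j
  refine ⟨|C|, fun z hz => (hC z hz).trans ?_⟩
  have hp := one_sub_pos_of_mem_cone hz
  calc C * (1 - z.1) ^ (a - j) ≤ |C| * (1 - z.1) ^ (a - j) := by gcongr; exact le_abs_self C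
    _ ≤ |C| * (1 - z.1) ^ (b - j) := mul_le_mul_of_nonneg_left
        (Real.rpow_le_rpow_of_exponent_ge hp (one_sub_le_one_of_mem_cone hz) (by linarith))
        (abs_nonneg C)

/-- It suffices to have the bounds near the tip of the cone. -/
lemma of_near_tip {f : Spacetime d → F} (hf : ContDiffOn ℝ ∞ f (past d))
    (h : ∀ j : ℕ, ∃ c C : ℝ, 0 < c ∧ ∀ z ∈ cone d, 1 - z.1 < c →
      ‖iteratedFDeriv ℝ j f z‖ ≤ C * (1 - z.1) ^ (a - j)) : IsSymbol a f := by
  refine ⟨hf, fun j => ?_⟩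
  obtain ⟨c, C, hc, hC⟩ := h j
  -- The part of the cone with 1 - t ≥ c lies in a compact subset of {t < 1}, where the weighted
  -- derivative is continuous, hence bounded.
  set K : Set (Spacetime d) := {z | 0 ≤ z.1 ∧ z.1 ≤ 1 - c ∧ ‖z.2‖ ≤ 2}
  have hK : IsCompact K := by
    refine ((isCompact_Icc (a := (0 : ℝ)) (b := 1 - c)).prod
      (isCompact_closedBall (0 : EuclideanSpace ℝ (Fin d)) 2)).of_isClosed_subset ?_ ?_
    · exact (isClosed_le continuous_const continuous_fst).inter
        ((isClosed_le continuous_fst continuous_const).inter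
          (isClosed_le continuous_snd.norm continuous_const))
    · rintro z ⟨h1, h2, h3⟩
      exact ⟨⟨h1, h2⟩, by simpa using h3⟩
  have hKp : K ⊆ past d := fun z hz => by
    have := hz.2.1
    change z.1 < 1
    linarith
  have hcont : ContinuousOn (fun z : Spacetime d =>
      iteratedFDeriv ℝ j f z) K := (continuousOn_iteratedFDeriv_past hf j).mono hKp
  have hcont' : ContinuousOn (fun z : Spacetime d => (1 - z.1) ^ (j - a)) K := by
    refine ContinuousOn.rpow_const (by fun_prop) fun z hz => Or.inl ?_
    exact (one_sub_pos_of_mem_past (hKp hz)).ne'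
  obtain ⟨M, hM⟩ := hK.exists_bound_of_continuousOn (hcont'.smul hcont)
  refine ⟨max C M, fun z hz => ?_⟩
  have hp := one_sub_pos_of_mem_cone hz
  by_cases hzc : 1 - z.1 < c
  · exact (hC z hz hzc).trans (by gcongr; exact le_max_left _ _)
  · have hzK : z ∈ K := ⟨hz.1, by linarith, by have := hz.2.2; have := hz.1; linarith⟩
    have h1 := hM z hzK
    rw [Pi.smul_apply', norm_smul, Real.norm_of_nonneg (by positivity)] at h1
    have h2 : (1 - z.1) ^ (a - j) * (1 - z.1) ^ (j - a) = 1 := by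
      rw [← Real.rpow_add hp]; simp
    calc ‖iteratedFDeriv ℝ j f z‖
        = (1 - z.1) ^ (a - j) * ((1 - z.1) ^ (j - a) * ‖iteratedFDeriv ℝ j f z‖) := by
          rw [← mul_assoc, h2, one_mul]
      _ ≤ (1 - z.1) ^ (a - j) * max C M := by gcongr; exact h1.trans (le_max_right _ _)
      _ = _ := mul_comm _ _

/-- Derivatives can be compared only where the functions agree on an open set. With c = 1 agreement
is required for t > 0 alone, which suits the recurrence, known only for t ≥ 0; the slice t = 0 is
recovered from smoothness through `of_near_tip`. -/
lemma congr_near_tip {f g : Spacetime d → F} (hg : IsSymbol a g) (hf : ContDiffOn ℝ ∞ f (past d))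
    {c : ℝ} (hc : 0 < c) (h : ∀ z : Spacetime d, z.1 < 1 → 1 - z.1 < c → f z = g z) :
    IsSymbol a f := by
  refine of_near_tip hf fun j => ?_
  obtain ⟨C, hC⟩ := hg.2 j
  refine ⟨c, C, hc, fun z hz hzc => ?_⟩
  have : f =ᶠ[𝓝 z] g := by
    have h1 : {y : Spacetime d | 1 - y.1 < c} ∈ 𝓝 z :=
      (isOpen_lt (continuous_const.sub continuous_fst) continuous_const).mem_nhds hzc
    filter_upwards [past_mem_nhds (cone_subset_past hz), h1] with y hy hy' using h y hy hy'
  rw [(this.iteratedFDeriv ℝ j).self_of_nhds]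
  exact hC z hz

lemma congr {f g : Spacetime d → F} (hg : IsSymbol a g) (h : ∀ z ∈ past d, f z = g z) :
    IsSymbol a f :=
  hg.congr_near_tip (hg.1.congr h) one_pos fun z hz _ => h z hz

lemma const (c : F) : IsSymbol 0 (fun _ : Spacetime d => c) := by
  refine ⟨contDiffOn_const, fun j => ⟨‖c‖, fun z hz => ?_⟩⟩
  have hp := one_sub_pos_of_mem_cone hz
  rcases eq_or_ne j 0 with rfl | hj
  · simp
  · rw [iteratedFDeriv_const_of_ne hj]
    simpa using by positivity

lemma zero (a : ℝ) : IsSymbol a (0 : Spacetime d → F) := by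
  refine ⟨contDiffOn_const, fun j => ⟨0, fun z _ => ?_⟩⟩
  have : iteratedFDeriv ℝ j (0 : Spacetime d → F) z = 0 := by
    simp
  simp [this]

lemma add {f g : Spacetime d → F} (hf : IsSymbol a f) (hg : IsSymbol a g) :
    IsSymbol a (f + g) := by
  refine ⟨hf.1.add hg.1, fun j => ?_⟩
  obtain ⟨C, hC⟩ := hf.2 j
  obtain ⟨C', hC'⟩ := hg.2 j
  refine ⟨C + C', fun z hz => ?_⟩
  have hz' := cone_subset_past hz
  rw [iteratedFDeriv_add_apply (contDiffAt_nat_of_past hf.1 hz' j)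
    (contDiffAt_nat_of_past hg.1 hz' j), add_mul]
  exact (norm_add_le _ _).trans (add_le_add (hC z hz) (hC' z hz))

lemma neg {f : Spacetime d → F} (hf : IsSymbol a f) : IsSymbol a (-f) := by
  refine ⟨hf.1.neg, fun j => ?_⟩
  obtain ⟨C, hC⟩ := hf.2 j
  refine ⟨C, fun z hz => ?_⟩
  rw [iteratedFDeriv_neg_apply, norm_neg]
  exact hC z hz

lemma sub {f g : Spacetime d → F} (hf : IsSymbol a f) (hg : IsSymbol a g) :
    IsSymbol a (f - g) := by
  rw [sub_eq_add_neg]; exact hf.add hg.neg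

lemma sum {ι : Type*} {s : Finset ι} {f : ι → Spacetime d → F}
    (h : ∀ i ∈ s, IsSymbol a (f i)) : IsSymbol a (∑ i ∈ s, f i) := by
  classical
  induction s using Finset.induction_on with
  | empty => simpa using zero a
  | insert i s hi ih =>
    rw [Finset.sum_insert hi]
    exact (h i (Finset.mem_insert_self _ _)).add
      (ih fun k hk => h k (Finset.mem_insert_of_mem hk))

lemma mul {f g : Spacetime d → ℝ} (hf : IsSymbol a f) (hg : IsSymbol b g) :
    IsSymbol (a + b) (f * g) := by
  refine ⟨hf.1.mul hg.1, fun j => ?_⟩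
  choose A hA using hf.2
  choose B hB using hg.2
  exact ⟨_, fun z hz => norm_iteratedFDeriv_mul_le_rpow hf.1 hg.1 (cone_subset_past hz)
    (fun i => hA i z hz) (fun i => hB i z hz) j⟩

lemma const_mul {f : Spacetime d → ℝ} (c : ℝ) (hf : IsSymbol a f) :
    IsSymbol a (fun z => c * f z) := by
  have := (const (d := d) c).mul hf
  rwa [zero_add] at this

lemma prod {ι : Type*} {s : Finset ι} {f : ι → Spacetime d → ℝ} {a : ι → ℝ}
    (h : ∀ i ∈ s, IsSymbol (a i) (f i)) : IsSymbol (∑ i ∈ s, a i) (∏ i ∈ s, f i) := by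
  classical
  induction s using Finset.induction_on with
  | empty => exact const (1 : ℝ)
  | insert i s hi ih =>
    rw [Finset.sum_insert hi, Finset.prod_insert hi]
    exact (h i (Finset.mem_insert_self _ _)).mul
      (ih fun k hk => h k (Finset.mem_insert_of_mem hk))

lemma pow {f : Spacetime d → ℝ} (hf : IsSymbol a f) (n : ℕ) : IsSymbol (n * a) (f ^ n) := by
  have := prod (s := Finset.range n) (f := fun _ => f) (a := fun _ => a) fun _ _ => hf
  simpa using this

lemma fderiv_apply {f : Spacetime d → ℝ} (hf : IsSymbol a f) (e : Spacetime d) :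
    IsSymbol (a - 1) (fun z => fderiv ℝ f z e) := by
  have h1 : ContDiffOn ℝ ∞ (fderiv ℝ f) (past d) :=
    hf.1.fderiv_of_isOpen isOpen_past (by simp)
  refine ⟨h1.clm_apply contDiffOn_const, fun j => ?_⟩
  obtain ⟨C, hC⟩ := hf.2 (j + 1)
  refine ⟨‖e‖ * C, fun z hz => ?_⟩
  refine (norm_iteratedFDeriv_clm_apply_const
    (contDiffAt_nat_of_past h1 (cone_subset_past hz) j) le_rfl).trans ?_
  rw [norm_iteratedFDeriv_fderiv, mul_assoc]
  have := hC z hz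
  push_cast at this
  rw [show a - (j + 1 : ℝ) = a - 1 - j by ring] at this
  gcongr

lemma dt {f : Spacetime d → ℝ} (hf : IsSymbol a f) : IsSymbol (a - 1) (dt f) :=
  hf.fderiv_apply _

lemma dx {f : Spacetime d → ℝ} (hf : IsSymbol a f) (i : Fin d) : IsSymbol (a - 1) (dx i f) :=
  hf.fderiv_apply _

lemma mink {f g : Spacetime d → ℝ} (hf : IsSymbol a f) (hg : IsSymbol b g) :
    IsSymbol (a + b - 2) (mink f g) := by
  have e : a - 1 + (b - 1) = a + b - 2 := by ring
  have h := ((hf.dt.mul hg.dt).neg).add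
    (sum (s := Finset.univ) fun i _ => (hf.dx i).mul (hg.dx i))
  rw [e] at h
  refine h.congr fun z _ => ?_
  simp [ImplodingWave.mink]

lemma box {f : Spacetime d → ℝ} (hf : IsSymbol a f) : IsSymbol (a - 2) (box f) := by
  have e : a - 1 - 1 = a - 2 := by ring
  have h := (hf.dt.dt.neg).add (sum (s := Finset.univ) fun i _ => (hf.dx i).dx i)
  rw [e] at h
  refine h.congr fun z _ => ?_
  simp [ImplodingWave.box]

lemma weightedBdd {f : Spacetime d → ℝ} (hf : IsSymbol a f) {j : ℕ} (h : j ≤ a + b) :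
    WeightedBdd b j f := by
  obtain ⟨C, hC⟩ := hf.2 j
  refine ⟨|C|, fun z hz => ?_⟩
  have hp := one_sub_pos_of_mem_cone hz
  calc (1 - z.1) ^ b * ‖iteratedFDeriv ℝ j f z‖
      ≤ (1 - z.1) ^ b * (C * (1 - z.1) ^ (a - j)) := by gcongr; exact hC z hz
    _ = C * (1 - z.1) ^ (a + b - j) := by
        rw [mul_left_comm, ← Real.rpow_add hp]; ring_nf
    _ ≤ |C| * (1 - z.1) ^ (a + b - j) := by gcongr; exact le_abs_self C
    _ ≤ |C| * 1 := by
        gcongr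
        exact Real.rpow_le_one hp.le (one_sub_le_one_of_mem_cone hz) (by linarith)
    _ = |C| := mul_one _

end IsSymbol

/-! ### Homogeneous functions are symbols -/

/-- Dilations about the tip `(1, 0)` of the cone. -/
def dilation (s : ℝ) (z : Spacetime d) : Spacetime d := (1 - s * (1 - z.1), s • z.2)

lemma hasFDerivAt_dilation (s : ℝ) (z : Spacetime d) :
    HasFDerivAt (dilation s) (s • ContinuousLinearMap.id ℝ (Spacetime d)) z := by
  have h : HasFDerivAt (fun y : Spacetime d => ((1 - s, 0) : Spacetime d) + s • y)
      (s • ContinuousLinearMap.id ℝ (Spacetime d)) z :=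
    ((hasFDerivAt_id z).const_smul s).const_add _
  convert h using 1
  ext y : 1
  refine Prod.ext ?_ ?_
  · simp [dilation]; ring
  · simp [dilation]

lemma dilation_mem_past {s : ℝ} (hs : 0 < s) {z : Spacetime d} (hz : z ∈ past d) :
    dilation s z ∈ past d := by
  have := mul_pos hs (one_sub_pos_of_mem_past hz)
  simp only [past, dilation, mem_ofPred_eq]; linarith

/-- A function which is homogeneous of degree `a` up to additive constants has a derivative which
is homogeneous of degree `a - 1`. -/
lemma fderiv_dilation {f : Spacetime d → F} (hf : ∀ z ∈ past d, DifferentiableAt ℝ f z) {a : ℝ}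
    {s : ℝ} (hs : 0 < s) {c : F} (h : ∀ z ∈ past d, f (dilation s z) = s ^ a • f z + c)
    {z : Spacetime d} (hz : z ∈ past d) :
    fderiv ℝ f (dilation s z) = s ^ (a - 1) • fderiv ℝ f z := by
  have h1 : HasFDerivAt (f ∘ dilation s)
      ((fderiv ℝ f (dilation s z)).comp (s • ContinuousLinearMap.id ℝ (Spacetime d))) z :=
    (hf _ (dilation_mem_past hs hz)).hasFDerivAt.comp z (hasFDerivAt_dilation s z)
  have h2 : HasFDerivAt (f ∘ dilation s) (s ^ a • fderiv ℝ f z) z :=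
    (((hf z hz).hasFDerivAt.const_smul (s ^ a)).add_const c).congr_of_eventuallyEq
      (by filter_upwards [past_mem_nhds hz] with y hy using h y hy)
  have h3 := h1.unique h2
  rw [ContinuousLinearMap.comp_smul, ContinuousLinearMap.comp_id] at h3
  rw [Real.rpow_sub_one hs.ne', div_eq_inv_mul, mul_smul, ← h3, inv_smul_smul₀ hs.ne']

lemma iteratedFDeriv_dilation {f : Spacetime d → F} (hf : ContDiffOn ℝ ∞ f (past d)) {a : ℝ}
    {s : ℝ} (hs : 0 < s) (h : ∀ z ∈ past d, f (dilation s z) = s ^ a • f z) (j : ℕ) :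
    ∀ z ∈ past d, iteratedFDeriv ℝ j f (dilation s z) = s ^ (a - j) • iteratedFDeriv ℝ j f z := by
  induction j with
  | zero =>
    intro z hz
    ext m
    simp [h z hz]
  | succ j ih =>
    intro z hz
    have h1 := fderiv_dilation (c := 0) (fun z hz =>
      (contDiffAt_of_past hf hz).differentiableAt_iteratedFDeriv (m := j)
        (WithTop.coe_lt_coe.2 (WithTop.coe_lt_top j))) hs
      (by simpa using ih) hz
    simp only [iteratedFDeriv_succ_eq_comp_left, Function.comp, h1, map_smul]
    push_cast
    rw [sub_sub]

/-- The dilation of ratio 1 - t carries (0, x/(1-t)) to (t, x). On the cone this base point stays in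
{0} × closed ball of radius 2, so compactness bounds the j-th derivative there, and homogeneity of
degree a - j transports the bound. -/
lemma IsSymbol.of_homogeneous {f : Spacetime d → F} (hf : ContDiffOn ℝ ∞ f (past d)) {a : ℝ}
    (h : ∀ s, 0 < s → ∀ z ∈ past d, f (dilation s z) = s ^ a • f z) : IsSymbol a f := by
  refine ⟨hf, fun j => ?_⟩
  set K : Set (Spacetime d) := {0} ×ˢ Metric.closedBall 0 2
  have hK : IsCompact K := isCompact_singleton.prod (isCompact_closedBall _ _)
  have hKp : K ⊆ past d := fun z hz => by
    have : z.1 = 0 := hz.1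
    simp [past, this]
  obtain ⟨C, hC⟩ := hK.exists_bound_of_continuousOn
    ((continuousOn_iteratedFDeriv_past hf j).mono hKp)
  refine ⟨C, fun z hz => ?_⟩
  have hp := one_sub_pos_of_mem_cone hz
  have hw : ((0, (1 - z.1)⁻¹ • z.2) : Spacetime d) ∈ K := by
    refine ⟨rfl, ?_⟩
    rw [mem_closedBall_zero_iff, norm_smul, norm_inv, Real.norm_of_nonneg hp.le,
      inv_mul_le_iff₀ hp]
    linarith [hz.2.2]
  have hd : dilation (1 - z.1) ((0, (1 - z.1)⁻¹ • z.2) : Spacetime d) = z := by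
    refine Prod.ext ?_ ?_
    · simp [dilation]
    · simp [dilation, smul_smul, mul_inv_cancel₀ hp.ne']
  have h1 := iteratedFDeriv_dilation hf hp (h _ hp) j _ (hKp hw)
  rw [hd] at h1
  rw [h1, norm_smul, Real.norm_of_nonneg (by positivity), mul_comm]
  gcongr
  exact hC _ hw

lemma contDiffOn_one_sub_rpow (a : ℝ) :
    ContDiffOn ℝ ∞ (fun z : Spacetime d => (1 - z.1) ^ a) (past d) :=
  (contDiff_const.sub contDiff_fst).contDiffOn.rpow_const_of_ne
    fun _ hz => (one_sub_pos_of_mem_past hz).ne'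

lemma isSymbol_rpow (a : ℝ) : IsSymbol a (fun z : Spacetime d => (1 - z.1) ^ a) := by
  refine IsSymbol.of_homogeneous (contDiffOn_one_sub_rpow a) fun s hs z hz => ?_
  have hp := one_sub_pos_of_mem_past hz
  simp only [dilation, smul_eq_mul]
  rw [← Real.mul_rpow hs.le hp.le]
  ring_nf

lemma contDiffOn_normSq_div :
    ContDiffOn ℝ ∞ (fun z : Spacetime d => ‖z.2‖ ^ 2 / (1 - z.1) ^ 2) (past d) :=
  (contDiff_snd.norm_sq ℝ).contDiffOn.div ((contDiff_const.sub contDiff_fst).pow 2).contDiffOn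
    fun _ hz => (pow_pos (one_sub_pos_of_mem_past hz) 2).ne'

/-- Homogeneity of degree 0. Evenness of the profile enters here: |x|² is smooth at x = 0 while |x|
is not. -/
lemma isSymbol_profile {g : ℝ → ℝ} (hg : ContDiffOn ℝ ∞ g (Ici 0)) :
    IsSymbol 0 (fun z : Spacetime d => g (‖z.2‖ ^ 2 / (1 - z.1) ^ 2)) := by
  refine IsSymbol.of_homogeneous (hg.comp contDiffOn_normSq_div fun z _ => ?_) fun s hs z hz => ?_
  · simp only [mem_Ici]; positivity
  · have hp := one_sub_pos_of_mem_past hz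
    rw [Real.rpow_zero, one_smul]
    change g _ = g _
    congr 1
    simp only [dilation, norm_smul, Real.norm_of_nonneg hs.le, sub_sub_cancel]
    field_simp

/-- A dilation changes the logarithm by an additive constant, so its derivative is homogeneous of
degree -1. Only the undifferentiated logarithm costs ε. -/
lemma isSymbol_log {ε : ℝ} (hε : 0 < ε) :
    IsSymbol (-ε) (fun z : Spacetime d => -Real.log (1 - z.1)) := by
  have hs : ContDiffOn ℝ ∞ (fun z : Spacetime d => -Real.log (1 - z.1)) (past d) :=
    ((contDiff_const.sub contDiff_fst).contDiffOn.log
      fun _ hz => (one_sub_pos_of_mem_past hz).ne').neg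
  refine ⟨hs, fun j => ?_⟩
  rcases j with _ | j
  · refine ⟨1 / ε, fun z hz => ?_⟩
    have hp := one_sub_pos_of_mem_cone hz
    have h0 : 0 ≤ -Real.log (1 - z.1) := by
      have := Real.log_nonpos hp.le (one_sub_le_one_of_mem_cone hz)
      linarith
    have h1 := Real.log_le_rpow_div (x := (1 - z.1)⁻¹) (by positivity) hε
    rw [Real.log_inv, Real.inv_rpow hp.le, ← Real.rpow_neg hp.le] at h1
    rw [norm_iteratedFDeriv_zero, Real.norm_of_nonneg h0]
    simpa [div_eq_inv_mul] using h1
  · have h1 : IsSymbol (-1) (fderiv ℝ (fun z : Spacetime d => -Real.log (1 - z.1))) := by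
      refine IsSymbol.of_homogeneous (hs.fderiv_of_isOpen isOpen_past (by simp))
        fun s hs' z hz => ?_
      have := fderiv_dilation (a := 0) (c := -Real.log s)
        (fun z hz => differentiableAt_of_past hs hz) hs' (fun z hz => ?_) hz
      · simpa using this
      · have hp := one_sub_pos_of_mem_past hz
        simp only [dilation, sub_sub_cancel, Real.rpow_zero, one_smul]
        rw [Real.log_mul hs'.ne' hp.ne']
        ring
    obtain ⟨C, hC⟩ := (h1.mono (b := -ε - 1) (by linarith)).2 j
    refine ⟨C, fun z hz => ?_⟩
    rw [← norm_iteratedFDeriv_fderiv]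
    refine (hC z hz).trans_eq ?_
    push_cast
    ring_nf

/-- Members of `𝒳_λ` are symbols of every order less than `λ`. -/
lemma isSymbol_of_mem_spaceX {lam a : ℝ} (ha : a < lam) {f : Spacetime d → ℝ}
    (hf : f ∈ SpaceX d lam) : IsSymbol a f := by
  obtain ⟨n, c, hc, hf⟩ := hf
  choose! g hg hcg using fun j hj => (hc j hj).2
  -- At most n logarithms occur in a product, so this loss per logarithm keeps the total below lam -
  -- a.
  have hε : 0 < (lam - a) / (n + 1) := by have := sub_pos.2 ha; positivity
  have key : IsSymbol (a - lam) (∑ j ∈ Finset.range (n + 1),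
      ((fun z : Spacetime d => g j (‖z.2‖ ^ 2 / (1 - z.1) ^ 2)) *
        (fun z : Spacetime d => -Real.log (1 - z.1)) ^ j)) := by
    refine IsSymbol.sum fun j hj => ?_
    have hjn : j ≤ n := Nat.lt_succ_iff.1 (Finset.mem_range.1 hj)
    refine ((isSymbol_profile (hg j hjn)).mul ((isSymbol_log hε).pow j)).mono ?_
    have h1 : (j : ℝ) ≤ n + 1 := by exact_mod_cast Nat.le_succ_of_le hjn
    have h2 : (j : ℝ) * ((lam - a) / (n + 1)) ≤ (n + 1) * ((lam - a) / (n + 1)) := by gcongr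
    rw [mul_div_cancel₀ _ (by positivity)] at h2
    linarith
  have := (isSymbol_rpow (d := d) lam).mul key
  rw [add_sub_cancel] at this
  refine this.congr fun z hz => ?_
  have hp := one_sub_pos_of_mem_past hz
  rw [hf z hz]
  simp only [Pi.mul_apply, Finset.sum_apply, Pi.pow_apply]
  congr 1
  refine Finset.sum_congr rfl fun j hj => ?_
  rw [hcg j (Nat.lt_succ_iff.1 (Finset.mem_range.1 hj)) _ (by positivity), div_pow]

end ImplodingWave

/-! ### Borel summation: truncated terms and the remainders of their sum. -/

namespace ImplodingWave

open Filter Topology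

variable {d : ℕ}

/-! ### Cutoffs at time scale `T` -/

/-- `η((1-t)/T)`. -/
noncomputable def cutoff (η : ℝ → ℝ) (T : ℝ) (z : Spacetime d) : ℝ := η ((1 - z.1) / T)

lemma contDiff_cutoff {η : ℝ → ℝ} (hη : IsBump η) (T : ℝ) :
    ContDiff ℝ ∞ (cutoff η T : Spacetime d → ℝ) :=
  hη.1.comp ((contDiff_const.sub contDiff_fst).div_const T)

lemma cutoff_eq_one {η : ℝ → ℝ} (hη : IsBump η) {T : ℝ} {z : Spacetime d} (hz : z ∈ past d)
    (h : 1 - z.1 ≤ T) : cutoff η T z = 1 := by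
  have hp := one_sub_pos_of_mem_past hz
  have hT : 0 < T := hp.trans_le h
  exact hη.2.2.2.1 _ ⟨by positivity, (div_le_one hT).2 h⟩

lemma cutoff_eq_zero {η : ℝ → ℝ} (hη : IsBump η) {T : ℝ} (hT : 0 < T) {z : Spacetime d}
    (h : 2 * T ≤ 1 - z.1) : cutoff η T z = 0 :=
  hη.2.2.2.2 _ ((le_div_iff₀ hT).2 h)

lemma cutoff_eventuallyEq_zero {η : ℝ → ℝ} (hη : IsBump η) {T : ℝ} (hT : 0 < T) {z : Spacetime d}
    (h : 2 * T < 1 - z.1) : cutoff η T =ᶠ[𝓝 z] 0 := by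
  have : {y : Spacetime d | 2 * T < 1 - y.1} ∈ 𝓝 z :=
    (isOpen_lt continuous_const (continuous_const.sub continuous_fst)).mem_nhds h
  filter_upwards [this] with y hy using cutoff_eq_zero hη hT (le_of_lt hy)

lemma IsBump.exists_bound {η : ℝ → ℝ} (hη : IsBump η) (j : ℕ) :
    ∃ C, 0 ≤ C ∧ ∀ i ≤ j, ∀ s, ‖iteratedFDeriv ℝ i η s‖ ≤ C := by
  have h : ∀ i : ℕ, ∃ C, ∀ s, ‖iteratedFDeriv ℝ i η s‖ ≤ C := fun i =>
    (hη.2.1.iteratedFDeriv i).exists_bound_of_continuous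
      (hη.1.continuous_iteratedFDeriv (mod_cast le_top))
  choose C hC using h
  refine ⟨∑ i ∈ Finset.range (j + 1), |C i|, by positivity, fun i hi s => ?_⟩
  refine (hC i s).trans ((le_abs_self _).trans ?_)
  exact Finset.single_le_sum (f := fun i => |C i|) (fun _ _ => abs_nonneg _)
    (Finset.mem_range.2 (Nat.lt_succ_of_le hi))

/-- The derivatives of the cutoffs are bounded uniformly in the time scale. -/
lemma norm_iteratedFDeriv_cutoff_le {η : ℝ → ℝ} (hη : IsBump η) (j : ℕ) :
    ∃ C, ∀ T, 0 < T → ∀ z ∈ past d,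
      ‖iteratedFDeriv ℝ j (cutoff η T : Spacetime d → ℝ) z‖ ≤ C * (1 - z.1) ^ (0 - (j : ℝ)) := by
  obtain ⟨C, hC0, hC⟩ := hη.exists_bound j
  -- Either the cutoff vanishes near z, or 1 - t ≤ 2T and then 1/T ≤ 3/(1-t). Each derivative of
  -- η((1-t)/T) brings a factor 1/T, hence 3^j; the factorial comes from the composition estimate.
  refine ⟨j.factorial * C * 3 ^ j, fun T hT z hz => ?_⟩
  have hp := one_sub_pos_of_mem_past hz
  rw [zero_sub, Real.rpow_neg hp.le, Real.rpow_natCast]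
  by_cases h : 2 * T < 1 - z.1
  · have h1 := ((cutoff_eventuallyEq_zero hη hT h).iteratedFDeriv ℝ j).self_of_nhds
    rw [h1]
    simp only [iteratedFDeriv_zero, Pi.zero_apply, norm_zero]
    positivity
  · set f : Spacetime d → ℝ := fun y => (1 - y.1) / T
    have hf : ContDiff ℝ ∞ f := (contDiff_const.sub contDiff_fst).div_const T
    have hfd : ∀ y, fderiv ℝ f y = -(T⁻¹ • ContinuousLinearMap.fst ℝ ℝ (EuclideanSpace ℝ (Fin d))) := fun y => by
      have : HasFDerivAt f (T⁻¹ • (-ContinuousLinearMap.fst ℝ ℝ (EuclideanSpace ℝ (Fin d)))) y := by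
        have h0 := ((hasFDerivAt_fst (𝕜 := ℝ) (p := y)).const_sub (1 : ℝ)).const_smul T⁻¹
        refine h0.congr_of_eventuallyEq (Eventually.of_forall fun w => ?_)
        simp [f, div_eq_inv_mul]
      rw [this.fderiv, smul_neg]
    have hD : ∀ i : ℕ, 1 ≤ i → i ≤ j → ‖iteratedFDeriv ℝ i f z‖ ≤ T⁻¹ ^ i := fun i hi _ => by
      obtain ⟨i, rfl⟩ := Nat.exists_eq_add_of_le' hi
      rw [← norm_iteratedFDeriv_fderiv, funext hfd]
      rcases eq_or_ne i 0 with rfl | hi0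
      · rw [norm_iteratedFDeriv_zero, norm_neg, norm_smul, norm_inv, Real.norm_of_nonneg hT.le]
        simp
      · rw [iteratedFDeriv_const_of_ne hi0]
        simpa using by positivity
    have h1 := norm_iteratedFDeriv_comp_le (g := η) (f := f) (n := j) hη.1 hf
      (mod_cast le_top) z (fun i hi => hC i hi _) hD
    refine (show ‖iteratedFDeriv ℝ j (cutoff η T) z‖ ≤ _ from h1).trans ?_
    have h2 : T⁻¹ ≤ 3 * (1 - z.1)⁻¹ := by
      rw [← div_eq_mul_inv, inv_le_comm₀ hT (by positivity), inv_div]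
      linarith
    calc (j.factorial : ℝ) * C * T⁻¹ ^ j ≤ j.factorial * C * (3 * (1 - z.1)⁻¹) ^ j := by gcongr
      _ = _ := by rw [mul_pow, inv_pow]; ring

lemma norm_iteratedFDeriv_cutoff_mul_le {η : ℝ → ℝ} (hη : IsBump η) {a : ℝ}
    {f : Spacetime d → ℝ} (hf : IsSymbol a f) (j : ℕ) :
    ∃ C, ∀ T, 0 < T → ∀ z ∈ cone d,
      ‖iteratedFDeriv ℝ j (cutoff η T * f) z‖ ≤ C * (1 - z.1) ^ (a - j) := by
  choose A hA using norm_iteratedFDeriv_cutoff_le (d := d) hη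
  choose B hB using hf.2
  refine ⟨∑ i ∈ Finset.range (j + 1), (j.choose i : ℝ) * A i * B (j - i), fun T hT z hz => ?_⟩
  have := norm_iteratedFDeriv_mul_le_rpow (contDiff_cutoff hη T).contDiffOn hf.1
    (cone_subset_past hz) (fun i => hA i T hT z (cone_subset_past hz)) (fun i => hB i z hz) j
  rwa [zero_add] at this

/-- If the time scale is small, then the truncated symbol is small, up to an arbitrarily small loss
of decay. -/
lemma IsSymbol.exists_threshold {η : ℝ → ℝ} (hη : IsBump η) {a δ : ℝ} (hδ : 0 < δ)
    {f : Spacetime d → ℝ} (hf : IsSymbol a f) (n : ℕ) :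
    ∃ τ, 0 < τ ∧ ∀ T, 0 < T → T ≤ τ → ∀ j ≤ n, ∀ z ∈ cone d,
      ‖iteratedFDeriv ℝ j (cutoff η T * f) z‖ ≤ (1 / 2) ^ n * (1 - z.1) ^ (a - δ - j) := by
  choose C hC using norm_iteratedFDeriv_cutoff_mul_le hη hf
  set M : ℝ := 1 + ∑ j ∈ Finset.range (n + 1), |C j|
  have hM : 0 < M := by positivity
  have hCM : ∀ j ≤ n, C j ≤ M := fun j hj => by
    have := Finset.single_le_sum (f := fun j => |C j|) (fun _ _ => abs_nonneg _)
      (Finset.mem_range.2 (Nat.lt_succ_of_le hj))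
    have := le_abs_self (C j)
    simp only [M]; linarith
  -- Where the cutoff does not vanish locally, 1 - t ≤ 2T ≤ 3τ, so this τ gives M (1-t)^δ ≤ 2^{-n}:
  -- the sacrificed power of 1 - t pays for the constants of all derivatives up to order n.
  refine ⟨((1 / 2) ^ n / M) ^ (1 / δ) / 3, by positivity, fun T hT hTτ j hj z hz => ?_⟩
  have hp := one_sub_pos_of_mem_cone hz
  by_cases h : 2 * T < 1 - z.1
  · have h0 : cutoff η T * f =ᶠ[𝓝 z] 0 := by
      filter_upwards [cutoff_eventuallyEq_zero hη hT h] with y hy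
      simp [hy]
    rw [(h0.iteratedFDeriv ℝ j).self_of_nhds]
    simp only [iteratedFDeriv_zero, Pi.zero_apply, norm_zero]
    positivity
  · have h1 : 1 - z.1 ≤ ((1 / 2) ^ n / M) ^ (1 / δ) := by linarith
    have h2 : (1 - z.1) ^ δ ≤ (1 / 2) ^ n / M := by
      calc (1 - z.1) ^ δ ≤ (((1 / 2) ^ n / M) ^ (1 / δ)) ^ δ := by gcongr
        _ = _ := by rw [← Real.rpow_mul (by positivity), one_div_mul_cancel hδ.ne', Real.rpow_one]
    calc _ ≤ C j * (1 - z.1) ^ (a - j) := hC j T hT z hz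
      _ ≤ M * (1 - z.1) ^ (a - j) := by gcongr; exact hCM j hj
      _ = M * (1 - z.1) ^ δ * (1 - z.1) ^ (a - δ - j) := by
          rw [mul_assoc, ← Real.rpow_add hp]; ring_nf
      _ ≤ M * ((1 / 2) ^ n / M) * (1 - z.1) ^ (a - δ - j) := by gcongr
      _ = _ := by rw [mul_div_cancel₀ _ hM.ne']

/-! ### Truncated series -/

section Series

variable {η : ℝ → ℝ} {T : ℕ → ℝ}

lemma exists_two_mul_time_le (hT : ∀ n, T n ≤ (1 / 4) ^ n) {w : ℝ} (hw : 0 < w) :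
    ∃ M, ∀ n, M ≤ n → 2 * T n ≤ w := by
  obtain ⟨M, hM⟩ := exists_pow_lt_of_lt_one (half_pos hw) (show (1 / 4 : ℝ) < 1 by norm_num)
  refine ⟨M, fun n hn => ?_⟩
  have := hT n
  have : (1 / 4 : ℝ) ^ n ≤ (1 / 4) ^ M := pow_le_pow_of_le_one (by norm_num) (by norm_num) hn
  linarith

/-- The truncated series is finite at each time. -/
lemma finite_setOf_bump_ne_zero (hη : IsBump η) (hT0 : ∀ n, 0 < T n)
    (hT : ∀ n, T n ≤ (1 / 4) ^ n) {t : ℝ} (ht : t < 1) :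
    {n : ℕ | η ((1 - t) / T n) ≠ 0}.Finite := by
  obtain ⟨M, hM⟩ := exists_two_mul_time_le hT (sub_pos.2 ht)
  refine (Set.finite_lt_nat M).subset fun n hn => ?_
  by_contra h
  exact hn (hη.2.2.2.2 _ ((le_div_iff₀ (hT0 n)).2 (hM n (not_lt.1 h))))

/-- The truncated series is locally a finite sum. -/
lemma truncSum_eventuallyEq (hη : IsBump η) (hT0 : ∀ n, 0 < T n) (hT : ∀ n, T n ≤ (1 / 4) ^ n)
    (f : ℕ → Spacetime d → ℝ) {z : Spacetime d} (hz : z ∈ past d) (N : ℕ) :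
    ∃ M, N ≤ M ∧ truncSum η T f =ᶠ[𝓝 z] ∑ n ∈ Finset.range M, cutoff η (T n) * f n := by
  have hp := one_sub_pos_of_mem_past hz
  -- Half of 1 - t is used so that the tail vanishes on a whole neighbourhood of z, and not just at
  -- z.
  obtain ⟨M, hM⟩ := exists_two_mul_time_le hT (half_pos hp)
  refine ⟨max M N, le_max_right _ _, ?_⟩
  have : {y : Spacetime d | (1 - z.1) / 2 < 1 - y.1} ∈ 𝓝 z :=
    (isOpen_lt continuous_const (continuous_const.sub continuous_fst)).mem_nhds
      (half_lt_self hp)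
  filter_upwards [this] with y hy
  rw [truncSum, tsum_eq_sum (s := Finset.range (max M N)), Finset.sum_apply]
  · rfl
  · intro n hn
    have hn' : M ≤ n := (le_max_left _ _).trans (not_lt.1 fun h => hn (Finset.mem_range.2 h))
    have := cutoff_eq_zero (z := y) hη (hT0 n) ((hM n hn').trans (le_of_lt hy))
    rw [cutoff] at this
    rw [this, zero_mul]

lemma contDiffOn_truncSum (hη : IsBump η) (hT0 : ∀ n, 0 < T n) (hT : ∀ n, T n ≤ (1 / 4) ^ n)
    {f : ℕ → Spacetime d → ℝ} (hf : ∀ n, ContDiffOn ℝ ∞ (f n) (past d)) :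
    ContDiffOn ℝ ∞ (truncSum η T f) (past d) := fun z hz => by
  obtain ⟨M, -, hM⟩ := truncSum_eventuallyEq hη hT0 hT f hz 0
  refine (ContDiffAt.congr_of_eventuallyEq ?_ hM).contDiffWithinAt
  rw [show (∑ n ∈ Finset.range M, cutoff η (T n) * f n) =
    fun y => ∑ n ∈ Finset.range M, cutoff η (T n) y * f n y by ext; simp]
  exact ContDiffAt.sum fun n _ =>
    (contDiff_cutoff hη (T n)).contDiffAt.mul (contDiffAt_of_past (hf n) hz)

/-- The remainders of the truncated series. -/
lemma isSymbol_truncSum_sub (hη : IsBump η) (hT0 : ∀ n, 0 < T n) (hT : ∀ n, T n ≤ (1 / 4) ^ n)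
    (hanti : Antitone T) {a δ : ℝ} (hδ : 0 ≤ δ) {f : ℕ → Spacetime d → ℝ}
    (hf : ∀ n : ℕ, IsSymbol (a + n * δ) (f n))
    (hτ : ∀ n : ℕ, 1 ≤ n → ∀ j ≤ n, ∀ z ∈ cone d, ‖iteratedFDeriv ℝ j (cutoff η (T n) * f n) z‖ ≤
      (1 / 2) ^ n * (1 - z.1) ^ (a + n * δ - δ - j)) (N : ℕ) :
    IsSymbol (a + N * δ) (truncSum η T f - ∑ n ∈ Finset.range (N + 1), f n) := by
  have hsm : ContDiffOn ℝ ∞ (truncSum η T f) (past d) :=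
    contDiffOn_truncSum hη hT0 hT fun n => (hf n).1
  have hsum : ∀ s : Finset ℕ, ContDiffOn ℝ ∞ (∑ n ∈ s, f n) (past d) := fun s => by
    rw [show (∑ n ∈ s, f n) = fun y => ∑ n ∈ s, f n y by ext; simp]
    exact ContDiffOn.sum fun n _ => (hf n).1
  refine IsSymbol.of_near_tip (hsm.sub (hsum _)) fun j => ?_
  choose C hC using fun n => norm_iteratedFDeriv_cutoff_mul_le hη (hf n) j
  -- For 1 - t < T N every cutoff of index at most N equals 1, so the partial sum cancels exactly.
  -- The finitely many terms with n < j, to which the smallness hypothesis does not apply,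
  -- contribute their own constants; the 2 bounds the geometric series of the others.
  refine ⟨T N, ∑ n ∈ Finset.range j, |C n| + 2, hT0 N, fun z hz hzN => ?_⟩
  have hp := one_sub_pos_of_mem_cone hz
  have hz' := cone_subset_past hz
  obtain ⟨M, hNM, hM⟩ := truncSum_eventuallyEq hη hT0 hT f hz' (N + 1)
  have hloc : truncSum η T f - ∑ n ∈ Finset.range (N + 1), f n =ᶠ[𝓝 z]
      ∑ n ∈ Finset.Ico (N + 1) M, cutoff η (T n) * f n := by
    have h1 : {y : Spacetime d | 1 - y.1 < T N} ∈ 𝓝 z :=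
      (isOpen_lt (continuous_const.sub continuous_fst) continuous_const).mem_nhds hzN
    filter_upwards [hM, h1, past_mem_nhds hz'] with y hy hy1 hy2
    rw [Pi.sub_apply, hy, sub_eq_iff_eq_add', Finset.sum_apply, Finset.sum_apply, Finset.sum_apply,
      ← Finset.sum_range_add_sum_Ico _ hNM]
    congr 1
    refine Finset.sum_congr rfl fun n hn => ?_
    have hn' : n ≤ N := Nat.lt_succ_iff.1 (Finset.mem_range.1 hn)
    rw [Pi.mul_apply, cutoff_eq_one hη hy2 ((le_of_lt hy1).trans (hanti hn')), one_mul]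
  rw [(hloc.iteratedFDeriv ℝ j).self_of_nhds, iteratedFDeriv_sum_apply (f := fun n => cutoff η (T n) * f n) fun n _ =>
    (((contDiff_cutoff hη (T n)).contDiffAt.mul (contDiffAt_of_past (hf n).1 hz')).of_le
      (mod_cast le_top))]
  -- Since n ≥ N + 1, the exponent a + nδ - δ is still at least a + Nδ: the loss of one δ uses up
  -- exactly the gain of one index.
  have hterm : ∀ n ∈ Finset.Ico (N + 1) M, ‖iteratedFDeriv ℝ j (cutoff η (T n) * f n) z‖ ≤
      ((if n < j then |C n| else 0) + (1 / 2) ^ n) * (1 - z.1) ^ (a + N * δ - j) := by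
    intro n hn
    have hn' : (N + 1 : ℝ) ≤ n := by exact_mod_cast (Finset.mem_Ico.1 hn).1
    have hnδ : (N + 1) * δ ≤ n * δ := by gcongr
    have hmono : ∀ b : ℝ, a + N * δ - j ≤ b →
        (1 - z.1) ^ b ≤ (1 - z.1) ^ (a + N * δ - j) := fun b hb =>
      Real.rpow_le_rpow_of_exponent_ge hp (one_sub_le_one_of_mem_cone hz) hb
    split_ifs with hnj
    · calc _ ≤ C n * (1 - z.1) ^ (a + n * δ - j) := hC n (T n) (hT0 n) z hz
        _ ≤ |C n| * (1 - z.1) ^ (a + n * δ - j) := by gcongr; exact le_abs_self _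
        _ ≤ (|C n| + (1 / 2) ^ n) * (1 - z.1) ^ (a + N * δ - j) := by
            exact mul_le_mul (le_add_of_nonneg_right (by positivity)) (hmono _ (by linarith))
              (by positivity) (by positivity)
    · calc _ ≤ (1 / 2) ^ n * (1 - z.1) ^ (a + n * δ - δ - j) :=
            hτ n ((Nat.le_add_left 1 N).trans (Finset.mem_Ico.1 hn).1) j (not_lt.1 hnj) z hz
        _ ≤ _ := by
            rw [zero_add]
            exact mul_le_mul_of_nonneg_left (hmono _ (by linarith)) (by positivity)
  refine (norm_sum_le _ _).trans ((Finset.sum_le_sum hterm).trans ?_)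
  rw [← Finset.sum_mul, Finset.sum_add_distrib]
  gcongr
  · rw [← Finset.sum_filter]
    refine Finset.sum_le_sum_of_subset_of_nonneg (fun n hn => ?_) fun _ _ _ => abs_nonneg _
    exact Finset.mem_range.2 (Finset.mem_filter.1 hn).2
  · refine (Finset.sum_le_sum_of_subset_of_nonneg (t := Finset.range M) (fun n hn => ?_)
      fun _ _ _ => by positivity).trans (sum_geometric_two_le M)
    exact Finset.mem_range.2 (Finset.mem_Ico.1 hn).2

end Series

end ImplodingWave

/-! ### Errors of partial sums and of functions asymptotic to them. -/

namespace ImplodingWave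

open Filter Topology

variable {d : ℕ}

/-! ### Linearity of the differential operators -/

lemma fderiv_add_apply_of_past {f g : Spacetime d → ℝ} (hf : ContDiffOn ℝ ∞ f (past d))
    (hg : ContDiffOn ℝ ∞ g (past d)) {z : Spacetime d} (hz : z ∈ past d) (e : Spacetime d) :
    fderiv ℝ (f + g) z e = fderiv ℝ f z e + fderiv ℝ g z e := by
  rw [fderiv_add (differentiableAt_of_past hf hz) (differentiableAt_of_past hg hz)]
  rfl

lemma contDiffOn_fderiv_apply {f : Spacetime d → ℝ} (hf : ContDiffOn ℝ ∞ f (past d))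
    (e : Spacetime d) : ContDiffOn ℝ ∞ (fun z => fderiv ℝ f z e) (past d) :=
  (hf.fderiv_of_isOpen isOpen_past (by simp)).clm_apply contDiffOn_const

lemma fderiv_apply_congr_of_past {f g : Spacetime d → ℝ} (h : ∀ z ∈ past d, f z = g z)
    {z : Spacetime d} (hz : z ∈ past d) (e : Spacetime d) :
    fderiv ℝ f z e = fderiv ℝ g z e := by
  have : f =ᶠ[𝓝 z] g := by filter_upwards [past_mem_nhds hz] with y hy using h y hy
  rw [this.fderiv_eq]

lemma dt_add {f g : Spacetime d → ℝ} (hf : ContDiffOn ℝ ∞ f (past d))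
    (hg : ContDiffOn ℝ ∞ g (past d)) {z : Spacetime d} (hz : z ∈ past d) :
    dt (f + g) z = dt f z + dt g z := fderiv_add_apply_of_past hf hg hz _

lemma dx_add {f g : Spacetime d → ℝ} (hf : ContDiffOn ℝ ∞ f (past d))
    (hg : ContDiffOn ℝ ∞ g (past d)) (i : Fin d) {z : Spacetime d} (hz : z ∈ past d) :
    dx i (f + g) z = dx i f z + dx i g z := fderiv_add_apply_of_past hf hg hz _

lemma mink_comm (f g : Spacetime d → ℝ) (z : Spacetime d) : mink f g z = mink g f z := by
  simp only [mink, mul_comm]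

lemma mink_add_left {f g h : Spacetime d → ℝ} (hf : ContDiffOn ℝ ∞ f (past d))
    (hg : ContDiffOn ℝ ∞ g (past d)) {z : Spacetime d} (hz : z ∈ past d) :
    mink (f + g) h z = mink f h z + mink g h z := by
  simp only [mink, dt_add hf hg hz, dx_add hf hg _ hz, add_mul, Finset.sum_add_distrib]
  ring

lemma mink_add_right {f g h : Spacetime d → ℝ} (hf : ContDiffOn ℝ ∞ f (past d))
    (hg : ContDiffOn ℝ ∞ g (past d)) {z : Spacetime d} (hz : z ∈ past d) :
    mink h (f + g) z = mink h f z + mink h g z := by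
  rw [mink_comm, mink_add_left hf hg hz, mink_comm f, mink_comm g]

lemma box_add {f g : Spacetime d → ℝ} (hf : ContDiffOn ℝ ∞ f (past d))
    (hg : ContDiffOn ℝ ∞ g (past d)) {z : Spacetime d} (hz : z ∈ past d) :
    box (f + g) z = box f z + box g z := by
  have key : ∀ e : Spacetime d,
      fderiv ℝ (fun y => fderiv ℝ (f + g) y e) z e =
        fderiv ℝ (fun y => fderiv ℝ f y e) z e + fderiv ℝ (fun y => fderiv ℝ g y e) z e := by
    intro e
    rw [← fderiv_add_apply_of_past (contDiffOn_fderiv_apply hf e) (contDiffOn_fderiv_apply hg e) hz]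
    exact fderiv_apply_congr_of_past (fun y hy => fderiv_add_apply_of_past hf hg hy e) hz e
  have ht : dt (dt (f + g)) z = dt (dt f) z + dt (dt g) z := key _
  have hx : ∀ i, dx i (dx i (f + g)) z = dx i (dx i f) z + dx i (dx i g) z := fun i => key _
  simp only [box, ht, hx, Finset.sum_add_distrib]
  ring

lemma contDiffOn_sum_past {ι : Type*} {s : Finset ι} {f : ι → Spacetime d → ℝ}
    (hf : ∀ n, ContDiffOn ℝ ∞ (f n) (past d)) : ContDiffOn ℝ ∞ (∑ n ∈ s, f n) (past d) := by
  rw [show (∑ n ∈ s, f n) = fun y => ∑ n ∈ s, f n y by ext; simp]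
  exact ContDiffOn.sum fun n _ => hf n

section Sums

variable {ι : Type*} {s : Finset ι} {f : ι → Spacetime d → ℝ} {z : Spacetime d}

lemma fderiv_sum_apply_of_past (hf : ∀ n, ContDiffOn ℝ ∞ (f n) (past d)) (hz : z ∈ past d)
    (e : Spacetime d) : fderiv ℝ (∑ n ∈ s, f n) z e = ∑ n ∈ s, fderiv ℝ (f n) z e := by
  rw [fderiv_sum fun n _ => differentiableAt_of_past (hf n) hz]
  simp

lemma dt_sum (hf : ∀ n, ContDiffOn ℝ ∞ (f n) (past d)) (hz : z ∈ past d) :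
    dt (∑ n ∈ s, f n) z = ∑ n ∈ s, dt (f n) z := fderiv_sum_apply_of_past hf hz _

lemma dx_sum (hf : ∀ n, ContDiffOn ℝ ∞ (f n) (past d)) (i : Fin d) (hz : z ∈ past d) :
    dx i (∑ n ∈ s, f n) z = ∑ n ∈ s, dx i (f n) z := fderiv_sum_apply_of_past hf hz _

lemma box_sum (hf : ∀ n, ContDiffOn ℝ ∞ (f n) (past d)) (hz : z ∈ past d) :
    box (∑ n ∈ s, f n) z = ∑ n ∈ s, box (f n) z := by
  classical
  induction s using Finset.induction_on with
  | empty =>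
    have h : ∀ e : Spacetime d, (fun y => fderiv ℝ (0 : Spacetime d → ℝ) y e) = 0 := fun e => by
      ext; simp
    have ht : dt (0 : Spacetime d → ℝ) = 0 := h _
    have hx : ∀ i, dx i (0 : Spacetime d → ℝ) = 0 := fun i => h _
    simp only [Finset.sum_empty, box, ht, hx, Pi.zero_apply, neg_zero, Finset.sum_const_zero,
      add_zero]
  | insert a s ha ih =>
    rw [Finset.sum_insert ha, Finset.sum_insert ha, box_add (hf a) (contDiffOn_sum_past hf) hz, ih]

end Sums

/-! ### Expansion of multilinear expressions in partial sums -/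

/-- A tuple of total degree at most N automatically has all entries at most N. The product of
partial sums thus contains the complete coefficient of each degree n ≤ N, which the recurrence
evaluates, plus terms of degree above N. -/
lemma sum_piFinset_range_eq {q : ℕ} (N : ℕ) (G : (Fin q → ℕ) → ℝ) :
    ∑ x ∈ Fintype.piFinset (fun _ : Fin q => Finset.range (N + 1)), G x =
      (∑ n ∈ Finset.range (N + 1), ∑ m ∈ Finset.Nat.antidiagonalTuple q n, G m) +
        ∑ x ∈ Fintype.piFinset (fun _ : Fin q => Finset.range (N + 1)) with N < ∑ i, x i, G x := by
  rw [← Finset.sum_filter_not_add_sum_filter _ (fun x : Fin q → ℕ => N < ∑ i, x i)]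
  congr 1
  rw [← Finset.sum_fiberwise_of_maps_to (g := fun x : Fin q → ℕ => ∑ i, x i)
    (t := Finset.range (N + 1))]
  · refine Finset.sum_congr rfl fun n hn => Finset.sum_congr ?_ fun _ _ => rfl
    have hn' := Finset.mem_range.1 hn
    ext x
    simp only [Finset.mem_filter, Fintype.mem_piFinset, Finset.mem_range,
      Finset.Nat.mem_antidiagonalTuple, not_lt]
    refine ⟨fun h => h.2, fun h => ⟨⟨fun i => ?_, by omega⟩, h⟩⟩
    have := Finset.single_le_sum (f := x) (fun _ _ => Nat.zero_le _) (Finset.mem_univ i)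
    omega
  · intro x hx
    have := (Finset.mem_filter.1 hx).2
    simp only [Finset.mem_range]
    omega

lemma sum_mul_sum_mul_sum (N : ℕ) (a b c : ℕ → ℝ) :
    (∑ n ∈ Finset.range N, a n) * ((∑ n ∈ Finset.range N, b n) * ∑ n ∈ Finset.range N, c n) =
      ∑ x ∈ Fintype.piFinset (fun _ : Fin 3 => Finset.range N), a (x 0) * (b (x 1) * c (x 2)) := by
  have := Finset.prod_univ_sum (fun _ : Fin 3 => Finset.range N) ![a, b, c]
  simpa [Fin.prod_univ_three, mul_assoc] using this

lemma sum_mul_sum_fin_two (N : ℕ) (a b : ℕ → ℝ) :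
    (∑ n ∈ Finset.range N, a n) * (∑ n ∈ Finset.range N, b n) =
      ∑ x ∈ Fintype.piFinset (fun _ : Fin 2 => Finset.range N), a (x 0) * b (x 1) := by
  have := Finset.prod_univ_sum (fun _ : Fin 2 => Finset.range N) ![a, b]
  simpa [Fin.prod_univ_two] using this

lemma sum_antidiagonalTuple_two (n : ℕ) (G : ℕ → ℕ → ℝ) :
    ∑ m ∈ Finset.Nat.antidiagonalTuple 2 n, G (m 0) (m 1) =
      ∑ m ∈ Finset.HasAntidiagonal.antidiagonal n, G m.1 m.2 := by
  rw [Finset.Nat.antidiagonalTuple_two, Finset.sum_map]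
  rfl

section PartialSums

variable {ρ φ : ℕ → Spacetime d → ℝ}

lemma errE_sum {p : ℕ} (hρ : ∀ n, ContDiffOn ℝ ∞ (ρ n) (past d))
    (hφ : ∀ n, ContDiffOn ℝ ∞ (φ n) (past d)) (N : ℕ) {z : Spacetime d} (hz : z ∈ past d) :
    errE p (∑ n ∈ Finset.range N, ρ n) (∑ n ∈ Finset.range N, φ n) z =
      (∑ x ∈ Fintype.piFinset (fun _ : Fin p => Finset.range N), ∏ i, ρ (x i) z) +
      (∑ x ∈ Fintype.piFinset (fun _ : Fin 3 => Finset.range N),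
        ρ (x 0) z * mink (φ (x 1)) (φ (x 2)) z) - ∑ n ∈ Finset.range N, box (ρ n) z := by
  have h1 : (∑ n ∈ Finset.range N, ρ n z) ^ p =
      ∑ x ∈ Fintype.piFinset (fun _ : Fin p => Finset.range N), ∏ i, ρ (x i) z := by
    have := Finset.prod_univ_sum (fun _ : Fin p => Finset.range N) fun _ n => ρ n z
    simpa using this
  rw [errE, box_sum hρ hz, mink, dt_sum hφ hz, Finset.sum_apply, h1]
  simp only [dx_sum hφ _ hz, mul_add, mul_neg, Finset.mul_sum (s := Finset.univ),
    sum_mul_sum_mul_sum, mink, Finset.sum_add_distrib, Finset.sum_neg_distrib]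
  rw [Finset.sum_comm]

lemma errJ_sum (hρ : ∀ n, ContDiffOn ℝ ∞ (ρ n) (past d))
    (hφ : ∀ n, ContDiffOn ℝ ∞ (φ n) (past d)) (N : ℕ) {z : Spacetime d} (hz : z ∈ past d) :
    errJ (∑ n ∈ Finset.range N, ρ n) (∑ n ∈ Finset.range N, φ n) z =
      ∑ x ∈ Fintype.piFinset (fun _ : Fin 2 => Finset.range N),
        (2 * mink (ρ (x 0)) (φ (x 1)) z + ρ (x 0) z * box (φ (x 1)) z) := by
  rw [errJ, box_sum hφ hz, mink, dt_sum hφ hz, dt_sum hρ hz, Finset.sum_apply]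
  simp only [dx_sum hφ _ hz, dx_sum hρ _ hz, sum_mul_sum_fin_two, mink, Finset.sum_add_distrib,
    Finset.sum_neg_distrib, ← Finset.mul_sum]
  rw [Finset.sum_comm]

end PartialSums

/-! ### The errors of the partial sums -/

lemma IsSymbol.add_pow_sub_pow {r m : ℝ} (hm : 0 ≤ m) {P R : Spacetime d → ℝ} (hP : IsSymbol r P)
    (hR : IsSymbol (r + m) R) (n : ℕ) : IsSymbol (n * r + m) ((P + R) ^ n - P ^ n) := by
  induction n with
  | zero => simpa using IsSymbol.zero (d := d) (F := ℝ) m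
  | succ n ih =>
    have e : (P + R) ^ (n + 1) - P ^ (n + 1) = ((P + R) ^ n - P ^ n) * (P + R) + P ^ n * R := by
      ring
    rw [e]
    refine ((ih.mul (hP.add (hR.mono (by linarith)))).mono ?_).add
      (((hP.pow n).mul hR).mono ?_) <;> push_cast <;> linarith

/-- Every term of the difference of the two errors contains a factor R or W and so gains m. The
three parts of E have different natural orders; B is any common lower bound for them. -/
lemma IsSymbol.errE_add {p : ℕ} {r s m B : ℝ} (hm : 0 ≤ m) {P Q R W : Spacetime d → ℝ}
    (hP : IsSymbol r P) (hQ : IsSymbol s Q) (hR : IsSymbol (r + m) R) (hW : IsSymbol (s + m) W)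
    (hB1 : B ≤ p * r) (hB2 : B ≤ r + 2 * s - 2) (hB3 : B ≤ r - 2)
    (hE : IsSymbol (B + m) (errE p P Q)) : IsSymbol (B + m) (errE p (P + R) (Q + W)) := by
  have hQW := hQ.add (hW.mono (b := s) (by linarith))
  have h1 := (hP.add_pow_sub_pow hm hR p).mono (b := B + m) (by linarith)
  have h2 := (hR.mul (hQW.mink hQW)).mono (b := B + m) (by linarith)
  have h3 := (hP.mul ((hQ.mink hW).add (hW.mink hQW |>.mono (by linarith)))).mono
    (b := B + m) (by linarith)
  have h4 := hR.box.mono (b := B + m) (by linarith)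
  refine ((((hE.add h1).add h2).add h3).sub h4).congr fun z hz => ?_
  simp only [errE, Pi.add_apply, Pi.sub_apply, Pi.mul_apply, Pi.pow_apply,
    box_add hP.1 hR.1 hz, mink_add_left hQ.1 hW.1 hz, mink_add_right hQ.1 hW.1 hz]
  ring

lemma IsSymbol.errJ_add {r s m : ℝ} (hm : 0 ≤ m) {P Q R W : Spacetime d → ℝ}
    (hP : IsSymbol r P) (hQ : IsSymbol s Q) (hR : IsSymbol (r + m) R) (hW : IsSymbol (s + m) W)
    (hJ : IsSymbol (r + s - 2 + m) (errJ P Q)) :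
    IsSymbol (r + s - 2 + m) (errJ (P + R) (Q + W)) := by
  have hQW := hQ.add (hW.mono (b := s) (by linarith))
  have h1 := ((hR.mink hQW).add ((hP.mink hW).mono (by linarith))).mono
    (b := r + s - 2 + m) (by linarith)
  have h2 := (hR.mul hQW.box).mono (b := r + s - 2 + m) (by linarith)
  have h3 := (hP.mul hW.box).mono (b := r + s - 2 + m) (by linarith)
  refine ((((hJ.add h1).add h1).add h2).add h3).congr fun z hz => ?_
  simp only [errJ, Pi.add_apply, Pi.mul_apply,
    box_add hQ.1 hW.1 hz, mink_add_left hP.1 hR.1 hz, mink_add_right hQ.1 hW.1 hz]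
  ring

section FormalSolution

variable {p : ℕ} {r s δ : ℝ} {ρ φ : ℕ → Spacetime d → ℝ}

lemma isSymbol_partialSum (hδ : 0 ≤ δ) {f : ℕ → Spacetime d → ℝ}
    (hf : ∀ n : ℕ, IsSymbol (r + n * δ) (f n)) (N : ℕ) :
    IsSymbol r (∑ n ∈ Finset.range N, f n) :=
  IsSymbol.sum fun n _ => (hf n).mono (le_add_of_nonneg_right (by positivity))

lemma sum_shift_eq {q : ℕ} (x : Fin q → ℕ) (r δ : ℝ) :
    ∑ i, (r + (x i : ℝ) * δ) = q * r + ((∑ i, x i : ℕ) : ℝ) * δ := by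
  simp [Finset.sum_add_distrib, Finset.sum_mul]

/-- The recurrence pairs □ρ_{n-1} with the nonlinear terms of degree n, and degree 0 cancels by
`h0`. What survives is □ρ_N, left unpaired by the index shift, and the products of total degree
above N. -/
lemma isSymbol_errE_partialSum (hδ : 0 ≤ δ) (hρ : ∀ n : ℕ, IsSymbol (r + n * δ) (ρ n))
    (hφ : ∀ n : ℕ, IsSymbol (s + n * δ) (φ n))
    (h0 : ∀ z ∈ past d, ρ 0 z ^ p + ρ 0 z * mink (φ 0) (φ 0) z = 0)
    (hrec : ∀ n : ℕ, 1 ≤ n → ∀ z : Spacetime d, 0 ≤ z.1 → z.1 < 1 → RecurrenceAt p ρ φ n z)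
    {B : ℝ} (hB1 : B ≤ p * r) (hB2 : B ≤ r + 2 * s - 2) (hB3 : B ≤ r - 2) (N : ℕ) :
    IsSymbol (B + N * δ)
      (errE p (∑ n ∈ Finset.range (N + 1), ρ n) (∑ n ∈ Finset.range (N + 1), φ n)) := by
  have hP := isSymbol_partialSum hδ hρ (N + 1)
  have hQ := isSymbol_partialSum hδ hφ (N + 1)
  have hsm : ContDiffOn ℝ ∞ (errE p (∑ n ∈ Finset.range (N + 1), ρ n)
      (∑ n ∈ Finset.range (N + 1), φ n)) (past d) :=
    ((hP.1.pow p).add (hP.1.mul (hQ.mink hQ).1)).sub hP.box.1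
  have hx : ∀ {q : ℕ} {x : Fin q → ℕ}, x ∈ (Fintype.piFinset (fun _ : Fin q => Finset.range (N + 1))).filter
        (fun x => N < ∑ i, x i) → (N : ℝ) * δ ≤ ((∑ i, x i : ℕ) : ℝ) * δ := by
    intro q x hx
    have : (N : ℝ) ≤ ((∑ i, x i : ℕ) : ℝ) := by exact_mod_cast (Finset.mem_filter.1 hx).2.le
    gcongr
  have h1 : IsSymbol (B + N * δ)
      (∑ x ∈ Fintype.piFinset (fun _ : Fin p => Finset.range (N + 1)) with N < ∑ i, x i,
        ∏ i, ρ (x i)) := IsSymbol.sum fun x hxm => by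
    refine (IsSymbol.prod fun i _ => hρ (x i)).mono ?_
    rw [sum_shift_eq]
    linarith [hx hxm]
  have h2 : IsSymbol (B + N * δ)
      (∑ x ∈ Fintype.piFinset (fun _ : Fin 3 => Finset.range (N + 1)) with N < ∑ i, x i,
        ρ (x 0) * mink (φ (x 1)) (φ (x 2))) := IsSymbol.sum fun x hxm => by
    refine ((hρ (x 0)).mul ((hφ (x 1)).mink (hφ (x 2)))).mono ?_
    have := hx hxm
    rw [Fin.sum_univ_three] at this
    push_cast at this
    linarith
  have h3 : IsSymbol (B + N * δ) (box (ρ N)) := (hρ N).box.mono (by linarith)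
  refine ((h1.add h2).sub h3).congr_near_tip hsm one_pos fun z hz hz0 => ?_
  have hz' : z ∈ past d := hz
  rw [errE_sum (fun n => (hρ n).1) (fun n => (hφ n).1) _ hz', sum_piFinset_range_eq,
    sum_piFinset_range_eq N (fun x : Fin 3 → ℕ => ρ (x 0) z * mink (φ (x 1)) (φ (x 2)) z)]
  -- Peeling off n = 0 with `Finset.sum_range_succ'` realises the index shift: degrees 1, …, N
  -- produce □ρ_0, …, □ρ_{N-1}.
  have hlow : (∑ n ∈ Finset.range (N + 1),
        ∑ m ∈ Finset.Nat.antidiagonalTuple p n, ∏ i, ρ (m i) z) +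
      (∑ n ∈ Finset.range (N + 1), ∑ m ∈ Finset.Nat.antidiagonalTuple 3 n,
        ρ (m 0) z * mink (φ (m 1)) (φ (m 2)) z) = ∑ n ∈ Finset.range N, box (ρ n) z := by
    rw [← Finset.sum_add_distrib, Finset.sum_range_succ', Finset.sum_congr rfl fun n _ =>
      ((hrec (n + 1) (Nat.le_add_left 1 n) z (by linarith) hz).1).symm]
    simpa [Finset.Nat.antidiagonalTuple_zero_right] using h0 z hz'
  rw [Finset.sum_range_succ (fun n => box (ρ n) z), ← hlow]
  simp only [Pi.add_apply, Pi.sub_apply, Pi.mul_apply, Finset.sum_apply, Finset.prod_apply]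
  ring

/-- Both parts of J have natural order r + s - 2 and the continuity equation has no index shift, so
all degrees up to N cancel completely. -/
lemma isSymbol_errJ_partialSum (hδ : 0 ≤ δ) (hρ : ∀ n : ℕ, IsSymbol (r + n * δ) (ρ n))
    (hφ : ∀ n : ℕ, IsSymbol (s + n * δ) (φ n))
    (h0 : ∀ z ∈ past d, 2 * mink (ρ 0) (φ 0) z + ρ 0 z * box (φ 0) z = 0)
    (hrec : ∀ n : ℕ, 1 ≤ n → ∀ z : Spacetime d, 0 ≤ z.1 → z.1 < 1 → RecurrenceAt p ρ φ n z)
    (N : ℕ) :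
    IsSymbol (r + s - 2 + N * δ)
      (errJ (∑ n ∈ Finset.range (N + 1), ρ n) (∑ n ∈ Finset.range (N + 1), φ n)) := by
  have hP := isSymbol_partialSum hδ hρ (N + 1)
  have hQ := isSymbol_partialSum hδ hφ (N + 1)
  have hsm : ContDiffOn ℝ ∞ (errJ (∑ n ∈ Finset.range (N + 1), ρ n)
      (∑ n ∈ Finset.range (N + 1), φ n)) (past d) :=
    (contDiffOn_const.mul (hP.mink hQ).1).add (hP.1.mul hQ.box.1)
  have h1 : IsSymbol (r + s - 2 + N * δ)
      (∑ x ∈ Fintype.piFinset (fun _ : Fin 2 => Finset.range (N + 1)) with N < ∑ i, x i,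
        ((fun z => 2 * mink (ρ (x 0)) (φ (x 1)) z) + ρ (x 0) * box (φ (x 1)))) :=
    IsSymbol.sum fun x hxm => by
      have hx : (N : ℝ) * δ ≤ (x 0 : ℝ) * δ + (x 1 : ℝ) * δ := by
        have h := (Finset.mem_filter.1 hxm).2.le
        rw [Fin.sum_univ_two] at h
        have : (N : ℝ) ≤ (x 0 : ℝ) + (x 1 : ℝ) := by exact_mod_cast h
        rw [← add_mul]
        gcongr
      exact ((((hρ (x 0)).mink (hφ (x 1))).const_mul 2).mono (by linarith)).add
        (((hρ (x 0)).mul (hφ (x 1)).box).mono (by linarith))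
  refine h1.congr_near_tip hsm one_pos fun z hz hz0 => ?_
  have hz' : z ∈ past d := hz
  rw [errJ_sum (fun n => (hρ n).1) (fun n => (hφ n).1) _ hz', sum_piFinset_range_eq N
    (fun x : Fin 2 → ℕ => 2 * mink (ρ (x 0)) (φ (x 1)) z + ρ (x 0) z * box (φ (x 1)) z)]
  have hlow : ∑ n ∈ Finset.range (N + 1), ∑ m ∈ Finset.Nat.antidiagonalTuple 2 n,
      (2 * mink (ρ (m 0)) (φ (m 1)) z + ρ (m 0) z * box (φ (m 1)) z) = 0 := by
    refine Finset.sum_eq_zero fun n _ => ?_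
    rw [sum_antidiagonalTuple_two n
      fun a b => 2 * mink (ρ a) (φ b) z + ρ a z * box (φ b) z]
    rcases Nat.eq_zero_or_pos n with rfl | hn
    · simpa using h0 z hz'
    · rw [Finset.sum_add_distrib, ← Finset.mul_sum]
      exact ((hrec n hn z (by linarith) hz).2).symm
  rw [hlow, zero_add]
  simp only [Pi.add_apply, Pi.mul_apply, Finset.sum_apply]

/-- Functions which are asymptotic, to all orders, to a formal solution have errors vanishing to
infinite order. -/
lemma isSymbol_err_of_asymptotic (hδ : 0 < δ) (hρ : ∀ n : ℕ, IsSymbol (r + n * δ) (ρ n))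
    (hφ : ∀ n : ℕ, IsSymbol (s + n * δ) (φ n))
    (hE0 : ∀ z ∈ past d, ρ 0 z ^ p + ρ 0 z * mink (φ 0) (φ 0) z = 0)
    (hJ0 : ∀ z ∈ past d, 2 * mink (ρ 0) (φ 0) z + ρ 0 z * box (φ 0) z = 0)
    (hrec : ∀ n : ℕ, 1 ≤ n → ∀ z : Spacetime d, 0 ≤ z.1 → z.1 < 1 → RecurrenceAt p ρ φ n z)
    {f g : Spacetime d → ℝ}
    (hf : ∀ N : ℕ, IsSymbol (r + N * δ) (f - ∑ n ∈ Finset.range (N + 1), ρ n))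
    (hg : ∀ N : ℕ, IsSymbol (s + N * δ) (g - ∑ n ∈ Finset.range (N + 1), φ n)) (A : ℝ) :
    IsSymbol A (errE p f g) ∧ IsSymbol A (errJ f g) := by
  obtain ⟨B, hB1, hB2, hB3, hB4⟩ :
      ∃ B : ℝ, B ≤ p * r ∧ B ≤ r + 2 * s - 2 ∧ B ≤ r - 2 ∧ B ≤ r + s - 2 :=
    ⟨min (min (p * r) (r + 2 * s - 2)) (min (r - 2) (r + s - 2)),
      (min_le_left _ _).trans (min_le_left _ _), (min_le_left _ _).trans (min_le_right _ _),
      (min_le_right _ _).trans (min_le_left _ _), (min_le_right _ _).trans (min_le_right _ _)⟩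
  obtain ⟨N, hN⟩ := exists_nat_ge ((A - B) / δ)
  rw [div_le_iff₀ hδ] at hN
  have hP := isSymbol_partialSum hδ.le hρ (N + 1)
  have hQ := isSymbol_partialSum hδ.le hφ (N + 1)
  have hm : 0 ≤ N * δ := by positivity
  have hE := hP.errE_add hm hQ (hf N) (hg N) hB1 hB2 hB3
    (isSymbol_errE_partialSum hδ.le hρ hφ hE0 hrec hB1 hB2 hB3 N)
  have hJ := hP.errJ_add hm hQ (hf N) (hg N) (isSymbol_errJ_partialSum hδ.le hρ hφ hJ0 hrec N)
  rw [add_sub_cancel, add_sub_cancel] at hE hJ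
  exact ⟨hE.mono (by linarith), hJ.mono (by linarith)⟩

end FormalSolution

end ImplodingWave

/-! ### The leading order term: regularity of the profile and the equations it solves. -/

namespace ImplodingWave

open Filter Topology

variable {d : ℕ}

/-! ### The profile in the variable `w = Z²` -/

lemma IsProfile.hasDerivAt {k ℓ β : ℝ} {v : ℝ → ℝ} (hv : IsProfile k ℓ β v) {Z : ℝ} (hZ : 0 < Z) :
    HasDerivAt v (derivWithin v (Ici 0) Z) Z :=
  ((hv.1.1.differentiableOn (by simp)) Z hZ.le).hasDerivWithinAt.hasDerivAt (Ici_mem_nhds hZ)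

/-- The profile stays away from the curve `Z v = 1`. -/
lemma IsProfile.one_sub_mul_pos {k ℓ β : ℝ} (hℓ : 0 < ℓ) (hβ : 1 < β) {v : ℝ → ℝ}
    (hv : IsProfile k ℓ β v) {Z : ℝ} (hZ : 0 ≤ Z) : 0 < 1 - Z * v Z := by
  by_contra hcon
  -- If f were nonpositive somewhere, then at its first zero a the profile equation would give f'(a)
  -- > 0, whereas f > 0 on [0, a).
  set f : ℝ → ℝ := fun Z => 1 - Z * v Z
  have hf : ContinuousOn f (Ici 0) :=
    continuousOn_const.sub (continuousOn_id.mul hv.1.1.continuousOn)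
  set S : Set ℝ := Ici 0 ∩ f ⁻¹' Iic 0
  have hS : IsClosed S := hf.preimage_isClosed_of_isClosed isClosed_Ici isClosed_Iic
  have hSb : BddBelow S := ⟨0, fun x hx => hx.1⟩
  have h0S : sInf S ∈ S := hS.csInf_mem ⟨Z, hZ, not_lt.1 hcon⟩ hSb
  set a := sInf S
  have ha0 : 0 ≤ a := h0S.1
  have hf0 : f 0 = 1 := by simp [f]
  have hfa : f a = 0 := by
    obtain ⟨c, hc, hc0⟩ := intermediate_value_Icc' ha0 (hf.mono Icc_subset_Ici_self)
      (show (0 : ℝ) ∈ Icc (f a) (f 0) from ⟨h0S.2, by rw [hf0]; exact zero_le_one⟩)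
    have hac : a ≤ c := csInf_le hSb ⟨hc.1, hc0.le⟩
    rwa [le_antisymm hac hc.2]
  have hapos : 0 < a := ha0.lt_of_ne fun h => by rw [← h, hf0] at hfa; exact one_ne_zero hfa
  have hva : a * v a = 1 := by simp only [f] at hfa; linarith
  obtain ⟨hvI, hode⟩ := hv.2.2 a ha0
  have hder := hv.hasDerivAt hapos
  set v' := derivWithin v (Ici 0) a
  have hfd : HasDerivAt f (-(1 * v a + a * v')) a := ((hasDerivAt_id a).mul hder).const_sub 1
  have hv1 : 0 < v a := by
    by_contra h
    nlinarith [mul_nonneg ha0 (neg_nonneg.2 (not_lt.1 h))]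
  have hlt : v a < a := by nlinarith [hvI.2]
  -- From a v(a) = 1 follows a - v = a(1 - v²), so the profile equation at a reads -ℓ a³ (1-v²)² v'
  -- = β ℓ a (1-v²)². Hence a f'(a) = -(1 + a² v') = β - 1 > 0.
  have hv' : a ^ 2 * v' = -β := by
    have h1 : a = (v a)⁻¹ := eq_inv_of_mul_eq_one_left hva
    have h2 : a - v a = a * (1 - v a ^ 2) := by linear_combination v a * hva
    have h3 : 0 < 1 - v a ^ 2 := by nlinarith [hvI.2]
    have h4 : -(ℓ * a * (1 - v a ^ 2) ^ 2) * (a ^ 2 * v' + β) = 0 := by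
      rw [DeltaZ, DeltaV, hva, show (v a - a) ^ 2 = (a * (1 - v a ^ 2)) ^ 2 by rw [← h2]; ring]
        at hode
      linear_combination hode
    have h5 : ℓ * a * (1 - v a ^ 2) ^ 2 ≠ 0 := by positivity
    have := (mul_eq_zero.1 h4).resolve_left (neg_ne_zero.2 h5)
    linarith
  have hpos : 0 < deriv f a := by
    rw [hfd.deriv]
    have : 0 < a * -(1 * v a + a * v') := by nlinarith
    exact (pos_iff_pos_of_mul_pos this).1 hapos
  have hev := eventually_nhdsWithin_sign_eq_of_deriv_pos hpos hfa
  have hev2 : ∀ᶠ x in 𝓝[<] a, SignType.sign (f x) = SignType.sign (x - a) ∧ 0 < x :=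
    (hev.filter_mono nhdsWithin_le_nhds).and
      ((lt_mem_nhds hapos).filter_mono nhdsWithin_le_nhds)
  obtain ⟨x, ⟨hx, hx0⟩, hxa⟩ := (hev2.and self_mem_nhdsWithin).exists
  rw [sign_neg (sub_neg.2 hxa), sign_eq_neg_one_iff] at hx
  exact absurd (csInf_le hSb ⟨hx0.le, hx.le⟩) (not_le.2 hxa)

/-- The properties of the function `g` for which `v(Z) = Z g(Z²)` is a profile. -/
structure IsReducedProfile (k ℓ β : ℝ) (g : ℝ → ℝ) : Prop where
  smooth : ContDiffOn ℝ ∞ g (Ici 0)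
  one_sub_mul_pos : ∀ w, 0 ≤ w → 0 < 1 - w * g w
  one_sub_mul_sq_pos : ∀ w, 0 ≤ w → 0 < 1 - w * g w ^ 2
  ode : ∀ w, 0 < w → ((1 - w * g w) ^ 2 - ℓ * w * (g w - 1) ^ 2) * (g w + 2 * w * deriv g w) =
    (1 - w * g w ^ 2) * (β * ℓ * (1 - w * g w ^ 2) - k * g w * (1 - w * g w))

lemma IsReducedProfile.hasDerivAt {k ℓ β : ℝ} {g : ℝ → ℝ} (hg : IsReducedProfile k ℓ β g) {w : ℝ}
    (hw : 0 < w) : HasDerivAt g (deriv g w) w :=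
  ((hg.smooth.contDiffAt (Ici_mem_nhds hw)).differentiableAt (by simp)).hasDerivAt

lemma IsProfile.exists_reduced {k ℓ β : ℝ} (hℓ : 0 < ℓ) (hβ : 1 < β) {v : ℝ → ℝ}
    (hv : IsProfile k ℓ β v) :
    ∃ g, IsReducedProfile k ℓ β g ∧ ∀ Z, 0 ≤ Z → v Z = Z * g (Z ^ 2) := by
  obtain ⟨g, hg, hvg⟩ := hv.1.2
  have hsq : ∀ w : ℝ, 0 ≤ w → v √w = √w * g w := fun w hw => by
    rw [hvg _ (Real.sqrt_nonneg w), Real.sq_sqrt hw]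
  refine ⟨g, ⟨hg, fun w hw => ?_, fun w hw => ?_, fun w hw => ?_⟩, hvg⟩
  · have := hv.one_sub_mul_pos hℓ hβ (Real.sqrt_nonneg w)
    rwa [hsq w hw, ← mul_assoc, Real.mul_self_sqrt hw] at this
  · have h := (hv.2.2 _ (Real.sqrt_nonneg w)).1
    have h1 : v √w ^ 2 = w * g w ^ 2 := by rw [hsq w hw, mul_pow, Real.sq_sqrt hw]
    rw [← h1]
    nlinarith [h.1, h.2]
  · set Z := √w
    have hZ : 0 < Z := Real.sqrt_pos.2 hw
    have hZw : w = Z ^ 2 := (Real.sq_sqrt hw.le).symm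
    have hd := ((hg.contDiffAt (Ici_mem_nhds hw)).differentiableAt (by simp)).hasDerivAt
    rw [hZw] at hd ⊢
    have hd2 : HasDerivAt (fun Z => Z * g (Z ^ 2))
        (1 * g (Z ^ 2) + Z * (deriv g (Z ^ 2) * (2 * Z))) Z := by
      have h1 := hd.comp Z (h := fun Z => Z ^ 2) (by simpa using hasDerivAt_pow 2 Z)
      exact (hasDerivAt_id Z).mul h1
    have heq : v =ᶠ[𝓝 Z] fun Z => Z * g (Z ^ 2) := by
      filter_upwards [Ici_mem_nhds hZ] with y hy using hvg y hy
    have hv' := (hv.hasDerivAt hZ).unique (hd2.congr_of_eventuallyEq heq)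
    have hode := (hv.2.2 Z hZ.le).2
    rw [hv', DeltaZ, DeltaV, hvg Z hZ.le] at hode
    -- Substituting v = Z g(Z²) and v' = g + 2w g' leaves a common factor Z in the equation.
    refine mul_left_cancel₀ hZ.ne' ?_
    linear_combination hode

/-- `∫_0^Z v/(1 - s v) ds` as a function of `w = Z²`. The integrand is extended to `w < 0` by a
constant. -/
noncomputable def phaseIntegral (g : ℝ → ℝ) (w : ℝ) : ℝ :=
  ∫ s in (0 : ℝ)..w, g (max s 0) / (2 * (1 - max s 0 * g (max s 0)))

/-- `∂_t φ₀` as a function of `w = Z²`. -/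
noncomputable def amplitude (β : ℝ) (g : ℝ → ℝ) (w : ℝ) : ℝ :=
  Real.exp ((β - 1) * phaseIntegral g w) / (1 - w * g w)

/-- `ρ̂₀` as a function of `w = Z²`. -/
noncomputable def density (p : ℕ) (β : ℝ) (g : ℝ → ℝ) (w : ℝ) : ℝ :=
  (amplitude β g w ^ 2 * (1 - w * g w ^ 2)) ^ (1 / ((p : ℝ) - 1))

section Reduced

variable {k ℓ β : ℝ} {g : ℝ → ℝ}

/-- The extension through `max s 0` makes the integrand continuous on the whole line, so the
derivative is two-sided even at w = 0. First derivatives of φ₀ can therefore be computed on the axis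
x = 0 too. -/
lemma IsReducedProfile.hasDerivAt_phaseIntegral (hg : IsReducedProfile k ℓ β g) {w : ℝ}
    (hw : 0 ≤ w) : HasDerivAt (phaseIntegral g) (g w / (2 * (1 - w * g w))) w := by
  have hm : Continuous fun s : ℝ => g (max s 0) :=
    hg.smooth.continuousOn.comp_continuous (by fun_prop) fun s => mem_Ici.2 (le_max_right _ _)
  have hc : Continuous fun s : ℝ => g (max s 0) / (2 * (1 - max s 0 * g (max s 0))) := by
    refine hm.div (continuous_const.mul
      (continuous_const.sub ((continuous_id.max continuous_const).mul hm))) fun s => ?_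
    have := hg.one_sub_mul_pos _ (le_max_right s 0)
    positivity
  have h := (hc.integral_hasStrictDerivAt 0 w).hasDerivAt
  rw [max_eq_left hw] at h
  exact h

lemma IsReducedProfile.contDiffOn_phaseIntegral (hg : IsReducedProfile k ℓ β g) :
    ContDiffOn ℝ ∞ (phaseIntegral g) (Ici 0) := by
  rw [contDiffOn_infty_iff_derivWithin (uniqueDiffOn_Ici 0)]
  refine ⟨fun w hw => (hg.hasDerivAt_phaseIntegral hw).differentiableAt.differentiableWithinAt, ?_⟩
  have : ContDiffOn ℝ ∞ (fun w => g w / (2 * (1 - w * g w))) (Ici 0) := by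
    refine hg.smooth.div (contDiffOn_const.mul (contDiffOn_const.sub (contDiffOn_id.mul hg.smooth)))
      fun w hw => ?_
    have := hg.one_sub_mul_pos w hw
    positivity
  exact this.congr fun w hw =>
    (hg.hasDerivAt_phaseIntegral hw).hasDerivWithinAt.derivWithin (uniqueDiffOn_Ici 0 w hw)

lemma IsReducedProfile.contDiffOn_amplitude (hg : IsReducedProfile k ℓ β g) :
    ContDiffOn ℝ ∞ (amplitude β g) (Ici 0) :=
  (contDiffOn_const.mul hg.contDiffOn_phaseIntegral).exp.div
    (contDiffOn_const.sub (contDiffOn_id.mul hg.smooth)) fun w hw => (hg.one_sub_mul_pos w hw).ne'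

lemma IsReducedProfile.amplitude_pos (hg : IsReducedProfile k ℓ β g) {w : ℝ} (hw : 0 ≤ w) :
    0 < amplitude β g w := div_pos (Real.exp_pos _) (hg.one_sub_mul_pos w hw)

lemma IsReducedProfile.density_base_pos (hg : IsReducedProfile k ℓ β g) {w : ℝ} (hw : 0 ≤ w) :
    0 < amplitude β g w ^ 2 * (1 - w * g w ^ 2) :=
  mul_pos (pow_pos (hg.amplitude_pos hw) 2) (hg.one_sub_mul_sq_pos w hw)

lemma IsReducedProfile.density_pos (hg : IsReducedProfile k ℓ β g) (p : ℕ) {w : ℝ} (hw : 0 ≤ w) :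
    0 < density p β g w := Real.rpow_pos_of_pos (hg.density_base_pos hw) _

lemma IsReducedProfile.contDiffOn_density (hg : IsReducedProfile k ℓ β g) (p : ℕ) :
    ContDiffOn ℝ ∞ (density p β g) (Ici 0) :=
  ((hg.contDiffOn_amplitude.pow 2).mul
    (contDiffOn_const.sub (contDiffOn_id.mul (hg.smooth.pow 2)))).rpow_const_of_ne
      fun _ hw => (hg.density_base_pos hw).ne'

lemma IsReducedProfile.integral_eq (hg : IsReducedProfile k ℓ β g) {v : ℝ → ℝ}
    (hv : ∀ Z, 0 ≤ Z → v Z = Z * g (Z ^ 2)) {Z : ℝ} (hZ : 0 ≤ Z) :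
    ∫ s in (0 : ℝ)..Z, v s / (1 - s * v s) = phaseIntegral g (Z ^ 2) := by
  have hd : ∀ s ∈ uIcc 0 Z, 
      HasDerivAt (fun s => phaseIntegral g (s ^ 2)) (v s / (1 - s * v s)) s := by
    intro s hs
    rw [uIcc_of_le hZ] at hs
    have h1 := (hg.hasDerivAt_phaseIntegral (sq_nonneg s)).comp s (h := fun s => s ^ 2)
      (by simpa using hasDerivAt_pow 2 s)
    refine h1.congr_deriv ?_
    have := (hg.one_sub_mul_pos _ (sq_nonneg s)).ne'
    rw [hv s hs.1, ← mul_assoc s s, ← sq]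
    field_simp
  have hvc : ContinuousOn v (uIcc 0 Z) := by
    rw [uIcc_of_le hZ]
    have : ContinuousOn (fun Z => Z * g (Z ^ 2)) (Icc 0 Z) :=
      continuousOn_id.mul (hg.smooth.continuousOn.comp (by fun_prop) fun s _ => sq_nonneg s)
    exact this.congr fun s hs => hv s hs.1
  have hi : IntervalIntegrable (fun s => v s / (1 - s * v s)) MeasureTheory.volume 0 Z := by
    refine ContinuousOn.intervalIntegrable
      (hvc.div (continuousOn_const.sub (continuousOn_id.mul hvc)) fun s hs => ?_)
    rw [uIcc_of_le hZ] at hs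
    have := (hg.one_sub_mul_pos _ (sq_nonneg s)).ne'
    rwa [hv s hs.1, ← mul_assoc, ← sq]
  rw [intervalIntegral.integral_eq_sub_of_hasDerivAt hd hi]
  simp [phaseIntegral]

lemma IsReducedProfile.phiHat_eq (hg : IsReducedProfile k ℓ β g) {v : ℝ → ℝ}
    (hv : ∀ Z, 0 ≤ Z → v Z = Z * g (Z ^ 2)) {Z : ℝ} (hZ : 0 ≤ Z) :
    phiHat β v Z = 1 / (β - 1) * Real.exp ((β - 1) * phaseIntegral g (Z ^ 2)) := by
  rw [phiHat, hg.integral_eq hv hZ]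

/-- All factors are powers with exponent 1/(p-1) of positive quantities and merge into one power;
the factor β - 1 cancels the 1/(β-1) in φ̂₀. -/
lemma IsReducedProfile.rhoHat_eq (hg : IsReducedProfile k ℓ β g) (hβ : 1 < β) {v : ℝ → ℝ}
    (hv : ∀ Z, 0 ≤ Z → v Z = Z * g (Z ^ 2)) (p : ℕ) {Z : ℝ} (hZ : 0 ≤ Z) :
    rhoHat p β v Z = density p β g (Z ^ 2) := by
  have hb : 0 < β - 1 := sub_pos.2 hβ
  have hq := hg.one_sub_mul_pos _ (sq_nonneg Z)
  have hm := hg.one_sub_mul_sq_pos _ (sq_nonneg Z)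
  have e1 : Z * v Z = Z ^ 2 * g (Z ^ 2) := by rw [hv Z hZ]; ring
  have e2 : v Z ^ 2 = Z ^ 2 * g (Z ^ 2) ^ 2 := by rw [hv Z hZ]; ring
  have e3 : (2 : ℝ) / ((p : ℝ) - 1) = 2 * (1 / ((p : ℝ) - 1)) := by ring
  have hpow : ∀ x : ℝ, 0 ≤ x → x ^ (2 * (1 / ((p : ℝ) - 1))) = (x ^ 2) ^ (1 / ((p : ℝ) - 1)) :=
    fun x hx => by rw [Real.rpow_mul hx]; norm_num
  rw [rhoHat, hg.phiHat_eq hv hZ, e1, e2, e3, hpow _ hb.le, hpow _ (by positivity), hpow _ hq.le,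
    ← Real.mul_rpow (by positivity) (by positivity), ← Real.mul_rpow (by positivity) hm.le,
    ← Real.div_rpow (by positivity) (by positivity), density, amplitude]
  congr 1
  field_simp

end Reduced

end ImplodingWave

namespace ImplodingWave

open Filter Topology

variable {d : ℕ}

/-! ### Calculus of functions of `|x|²/(1-t)²` -/

/-- `Z² = |x|²/(1-t)²`. -/
noncomputable def simVar (z : Spacetime d) : ℝ := ‖z.2‖ ^ 2 / (1 - z.1) ^ 2

lemma simVar_nonneg (z : Spacetime d) : 0 ≤ simVar z := by unfold simVar; positivity

lemma simVar_pos {z : Spacetime d} (hz : z ∈ past d) (hx : z.2 ≠ 0) : 0 < simVar z := by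
  have := one_sub_pos_of_mem_past hz
  have := norm_pos_iff.2 hx
  unfold simVar; positivity

lemma normSq_eq_simVar_mul {z : Spacetime d} (hz : z ∈ past d) :
    ‖z.2‖ ^ 2 = simVar z * (1 - z.1) ^ 2 := by
  have := one_sub_pos_of_mem_past hz
  unfold simVar; field_simp

/-- The derivative of `(1-t)^a G(Z²)`. -/
lemma hasFDerivAt_selfSimilar {a G' : ℝ} {G : ℝ → ℝ} {z : Spacetime d} (hz : z ∈ past d)
    (hG : HasDerivAt G G' (simVar z)) :
    HasFDerivAt (fun y : Spacetime d => (1 - y.1) ^ a * G (simVar y))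
      (((1 - z.1) ^ (a - 1) * (-a * G (simVar z) + 2 * simVar z * G')) •
          ContinuousLinearMap.fst ℝ ℝ (EuclideanSpace ℝ (Fin d)) +
        (2 * (1 - z.1) ^ (a - 2) * G') •
          (innerSL ℝ z.2).comp (ContinuousLinearMap.snd ℝ ℝ (EuclideanSpace ℝ (Fin d)))) z := by
  have hp := one_sub_pos_of_mem_past hz
  have h1 : HasFDerivAt (fun y : Spacetime d => 1 - y.1)
      (-ContinuousLinearMap.fst ℝ ℝ (EuclideanSpace ℝ (Fin d))) z := hasFDerivAt_fst.const_sub 1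
  have h2 : HasFDerivAt (fun y : Spacetime d => ‖y.2‖ ^ 2)
      ((2 • innerSL ℝ z.2).comp (ContinuousLinearMap.snd ℝ ℝ (EuclideanSpace ℝ (Fin d)))) z :=
    (hasStrictFDerivAt_norm_sq z.2).hasFDerivAt.comp z hasFDerivAt_snd
  have h3 := (hasDerivAt_inv (pow_pos hp 2).ne').comp_hasFDerivAt z (h1.pow 2)
  have h4 : HasFDerivAt (simVar (d := d)) _ z :=
    (h2.mul h3).congr_of_eventuallyEq (Eventually.of_forall fun y => div_eq_mul_inv _ _)
  have h5 := (h1.rpow_const (p := a) (Or.inl hp.ne')).mul (hG.comp_hasFDerivAt z h4)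
  refine h5.congr_fderiv ?_
  have e1 : (1 - z.1) ^ (a - 1) = (1 - z.1) ^ a / (1 - z.1) := Real.rpow_sub_one hp.ne' a
  have e2 : (1 - z.1) ^ (a - 2) = (1 - z.1) ^ a / (1 - z.1) ^ 2 := by
    rw [Real.rpow_sub hp]; norm_num
  ext e
  · simp [e1, e2, simVar]
    field_simp
    ring
  · simp [e1, e2, simVar]
    field_simp

lemma dt_selfSimilar {a G' : ℝ} {G : ℝ → ℝ} {z : Spacetime d} (hz : z ∈ past d)
    (hG : HasDerivAt G G' (simVar z)) :
    dt (fun y : Spacetime d => (1 - y.1) ^ a * G (simVar y)) z =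
      (1 - z.1) ^ (a - 1) * (-a * G (simVar z) + 2 * simVar z * G') := by
  rw [dt, (hasFDerivAt_selfSimilar hz hG).fderiv]
  simp

lemma dx_selfSimilar {a G' : ℝ} {G : ℝ → ℝ} {z : Spacetime d} (hz : z ∈ past d)
    (hG : HasDerivAt G G' (simVar z)) (i : Fin d) :
    dx i (fun y : Spacetime d => (1 - y.1) ^ a * G (simVar y)) z =
      2 * (1 - z.1) ^ (a - 2) * G' * z.2 i := by
  rw [dx, (hasFDerivAt_selfSimilar hz hG).fderiv]
  simp [EuclideanSpace.inner_single_right]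

lemma dx_selfSimilar_mul_coord {a G' : ℝ} {G : ℝ → ℝ} {z : Spacetime d} (hz : z ∈ past d)
    (hG : HasDerivAt G G' (simVar z)) (i : Fin d) :
    dx i (fun y : Spacetime d => (1 - y.1) ^ a * G (simVar y) * y.2 i) z =
      (1 - z.1) ^ a * G (simVar z) + 2 * (1 - z.1) ^ (a - 2) * G' * z.2 i ^ 2 := by
  have hc : HasFDerivAt (fun y : Spacetime d => y.2 i)
      ((EuclideanSpace.proj i).comp (ContinuousLinearMap.snd ℝ ℝ (EuclideanSpace ℝ (Fin d)))) z :=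
    ((EuclideanSpace.proj (𝕜 := ℝ) i).comp
      (ContinuousLinearMap.snd ℝ ℝ (EuclideanSpace ℝ (Fin d)))).hasFDerivAt
  rw [dx, ((hasFDerivAt_selfSimilar hz hG).fun_mul hc).fderiv]
  simp [EuclideanSpace.inner_single_right]
  ring

/-- Since g is only one-sidedly differentiable at w = 0, identities involving g' are proved off the
axis and extended by continuity. Positivity of d makes the complement of the axis dense. -/
lemma eqOn_past_of_eqOn_ne_zero (hd : 0 < d) {f g : Spacetime d → ℝ}
    (hf : ContinuousOn f (past d)) (hg : ContinuousOn g (past d))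
    (h : ∀ z ∈ past d, z.2 ≠ 0 → f z = g z) : EqOn f g (past d) := by
  have : Nonempty (Fin d) := ⟨⟨0, hd⟩⟩
  have hdense : Dense ((univ : Set ℝ) ×ˢ ({0}ᶜ : Set (EuclideanSpace ℝ (Fin d)))) :=
    dense_univ.prod (dense_compl_singleton 0)
  refine EqOn.of_subset_closure (s := past d ∩ (univ ×ˢ {0}ᶜ)) (fun z hz => h z hz.1 hz.2.2)
    hf hg inter_subset_left (hdense.open_subset_closure_inter isOpen_past)

/-! ### The leading order term -/

/-- `φ̂₀` as a function of `w = Z²`. -/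
noncomputable def potential (β : ℝ) (g : ℝ → ℝ) (w : ℝ) : ℝ :=
  1 / (β - 1) * Real.exp ((β - 1) * phaseIntegral g w)

section LeadingOrder

variable {k ℓ β : ℝ} {g : ℝ → ℝ} {φ ρ : Spacetime d → ℝ}

lemma phiZero_eq (hg : IsReducedProfile k ℓ β g) {v : ℝ → ℝ}
    (hv : ∀ Z, 0 ≤ Z → v Z = Z * g (Z ^ 2)) {z : Spacetime d} (hz : z ∈ past d) :
    phiZero β v z = (1 - z.1) ^ (1 - β) * potential β g (simVar z) := by
  have := one_sub_pos_of_mem_past hz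
  rw [phiZero, hg.phiHat_eq hv (by positivity), div_pow, potential, simVar]

lemma rhoZero_eq (hg : IsReducedProfile k ℓ β g) (hβ : 1 < β) {v : ℝ → ℝ}
    (hv : ∀ Z, 0 ≤ Z → v Z = Z * g (Z ^ 2)) (p : ℕ) {z : Spacetime d} (hz : z ∈ past d) :
    rhoZero p β v z = (1 - z.1) ^ (-(2 * β / ((p : ℝ) - 1))) * density p β g (simVar z) := by
  have := one_sub_pos_of_mem_past hz
  rw [rhoZero, hg.rhoHat_eq hβ hv p (by positivity), div_pow, simVar]

lemma isSymbol_selfSimilar {a : ℝ} {G : ℝ → ℝ} (hG : ContDiffOn ℝ ∞ G (Ici 0))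
    {f : Spacetime d → ℝ} (hf : ∀ z ∈ past d, f z = (1 - z.1) ^ a * G (simVar z)) :
    IsSymbol a f := by
  have := (isSymbol_rpow (d := d) a).mul (isSymbol_profile hG)
  rw [add_zero] at this
  exact this.congr hf

lemma IsReducedProfile.contDiffOn_potential (hg : IsReducedProfile k ℓ β g) :
    ContDiffOn ℝ ∞ (potential β g) (Ici 0) :=
  contDiffOn_const.mul (contDiffOn_const.mul hg.contDiffOn_phaseIntegral).exp

lemma IsReducedProfile.hasDerivAt_potential (hg : IsReducedProfile k ℓ β g) (hβ : 1 < β) {w : ℝ}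
    (hw : 0 ≤ w) : HasDerivAt (potential β g) (amplitude β g w * g w / 2) w := by
  have hb := (sub_pos.2 hβ).ne'
  have hq := (hg.one_sub_mul_pos w hw).ne'
  refine ((((hg.hasDerivAt_phaseIntegral hw).const_mul (β - 1)).exp).const_mul
    (1 / (β - 1))).congr_deriv ?_
  rw [amplitude]
  field_simp

/-- With A the amplitude and Φ the potential, (β-1)Φ = A(1 - wg) and 2wΦ' = A w g, so the two
contributions to the time derivative add up to A. -/
lemma dt_phiZero (hg : IsReducedProfile k ℓ β g) (hβ : 1 < β)
    (hφ : ∀ z ∈ past d, φ z = (1 - z.1) ^ (1 - β) * potential β g (simVar z))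
    {z : Spacetime d} (hz : z ∈ past d) :
    dt φ z = (1 - z.1) ^ (-β) * amplitude β g (simVar z) := by
  have hb := (sub_pos.2 hβ).ne'
  have hq := (hg.one_sub_mul_pos _ (simVar_nonneg z)).ne'
  rw [dt, fderiv_apply_congr_of_past hφ hz]
  refine (dt_selfSimilar hz (hg.hasDerivAt_potential hβ (simVar_nonneg z))).trans ?_
  rw [show 1 - β - 1 = -β by ring, potential, amplitude]
  field_simp
  ring

lemma dx_phiZero (hg : IsReducedProfile k ℓ β g) (hβ : 1 < β)
    (hφ : ∀ z ∈ past d, φ z = (1 - z.1) ^ (1 - β) * potential β g (simVar z))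
    {z : Spacetime d} (hz : z ∈ past d) (i : Fin d) :
    dx i φ z = (1 - z.1) ^ (-1 - β) * (amplitude β g (simVar z) * g (simVar z)) * z.2 i := by
  rw [dx, fderiv_apply_congr_of_past hφ hz]
  refine (dx_selfSimilar hz (hg.hasDerivAt_potential hβ (simVar_nonneg z)) i).trans ?_
  rw [show 1 - β - 2 = -1 - β by ring]
  ring

lemma sum_coord_sq (x : EuclideanSpace ℝ (Fin d)) : ∑ i, x i ^ 2 = ‖x‖ ^ 2 := by
  rw [EuclideanSpace.norm_sq_eq]
  simp

/-- The eikonal equation at leading order. -/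
lemma leading_order_E (hg : IsReducedProfile k ℓ β g) (hβ : 1 < β) {p : ℕ} (hp : 3 ≤ p)
    (hφ : ∀ z ∈ past d, φ z = (1 - z.1) ^ (1 - β) * potential β g (simVar z))
    (hρ : ∀ z ∈ past d,
      ρ z = (1 - z.1) ^ (-(2 * β / ((p : ℝ) - 1))) * density p β g (simVar z))
    {z : Spacetime d} (hz : z ∈ past d) : ρ z ^ p + ρ z * mink φ φ z = 0 := by
  have hθ := one_sub_pos_of_mem_past hz
  have hw := simVar_nonneg z
  have hp1 : (0 : ℝ) < (p : ℝ) - 1 := by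
    have : (3 : ℝ) ≤ p := by exact_mod_cast hp
    linarith
  have hpc : ((p - 1 : ℕ) : ℝ) = (p : ℝ) - 1 := by
    rw [Nat.cast_sub (by omega)]; simp
  -- The exponents in ρ₀ are such that ρ₀^{p-1} = (∂_tφ₀)² - |D_xφ₀|². Here and in `h2` the time
  -- factor and the profile factor are raised to the power p - 1 separately.
  have h1 : ((1 - z.1) ^ (-(2 * β / ((p : ℝ) - 1)))) ^ (p - 1) = ((1 - z.1) ^ (-β)) ^ 2 := by
    rw [← Real.rpow_natCast, ← Real.rpow_mul hθ.le, ← Real.rpow_natCast, ← Real.rpow_mul hθ.le, hpc]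
    congr 1
    push_cast
    field_simp
  have h2 : density p β g (simVar z) ^ (p - 1) =
      amplitude β g (simVar z) ^ 2 * (1 - simVar z * g (simVar z) ^ 2) := by
    rw [density, ← Real.rpow_natCast, ← Real.rpow_mul (hg.density_base_pos hw).le, hpc,
      one_div_mul_cancel hp1.ne', Real.rpow_one]
  have h3 : mink φ φ z = -(((1 - z.1) ^ (-β)) ^ 2 *
      (amplitude β g (simVar z) ^ 2 * (1 - simVar z * g (simVar z) ^ 2))) := by
    rw [mink, dt_phiZero hg hβ hφ hz]
    simp only [dx_phiZero hg hβ hφ hz]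
    have e : (1 - z.1) ^ (-1 - β) = (1 - z.1) ^ (-β) / (1 - z.1) := by
      rw [← Real.rpow_sub_one hθ.ne']; ring_nf
    have hs := sum_coord_sq z.2
    rw [normSq_eq_simVar_mul hz] at hs
    rw [show (∑ i, (1 - z.1) ^ (-1 - β) * (amplitude β g (simVar z) * g (simVar z)) * z.2 i *
        ((1 - z.1) ^ (-1 - β) * (amplitude β g (simVar z) * g (simVar z)) * z.2 i)) =
        ((1 - z.1) ^ (-1 - β) * (amplitude β g (simVar z) * g (simVar z))) ^ 2 * ∑ i, z.2 i ^ 2 by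
      rw [Finset.mul_sum]; exact Finset.sum_congr rfl fun i _ => by ring, hs, e]
    field_simp
    ring
  rw [h3, ← h1, ← h2, ← mul_pow, ← hρ z hz, mul_neg, ← pow_succ', Nat.sub_add_cancel (by omega),
    add_neg_cancel]

lemma box_phiZero (hg : IsReducedProfile k ℓ β g) (hβ : 1 < β)
    (hφ : ∀ z ∈ past d, φ z = (1 - z.1) ^ (1 - β) * potential β g (simVar z))
    {z : Spacetime d} (hz : z ∈ past d) {A' : ℝ}
    (hA : HasDerivAt (amplitude β g) A' (simVar z)) (hx : z.2 ≠ 0) :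
    box φ z = (1 - z.1) ^ (-β) / (1 - z.1) * (-(β * amplitude β g (simVar z) + 2 * simVar z * A') +
      d * (amplitude β g (simVar z) * g (simVar z)) +
      2 * simVar z * (A' * g (simVar z) + amplitude β g (simVar z) * deriv g (simVar z))) := by
  have hθ := one_sub_pos_of_mem_past hz
  have ht : dt (dt φ) z = _ :=
    (fderiv_apply_congr_of_past (fun y hy => dt_phiZero hg hβ hφ hy) hz _).trans
      (dt_selfSimilar hz hA)
  have hgd := hg.hasDerivAt (simVar_pos hz hx)
  have hxx : ∀ i, dx i (dx i φ) z = _ := fun i =>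
    (fderiv_apply_congr_of_past (fun y hy => dx_phiZero hg hβ hφ hy i) hz _).trans
      (dx_selfSimilar_mul_coord hz (hA.mul hgd) i)
  have e1 : (1 - z.1) ^ (-β - 1) = (1 - z.1) ^ (-β) / (1 - z.1) := Real.rpow_sub_one hθ.ne' _
  have e2 : (1 - z.1) ^ (-1 - β) = (1 - z.1) ^ (-β) / (1 - z.1) := by rw [← e1]; ring_nf
  have e3 : (1 - z.1) ^ (-1 - β - 2) = (1 - z.1) ^ (-β) / (1 - z.1) / (1 - z.1) ^ 2 := by
    rw [Real.rpow_sub hθ, e2]; norm_num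
  rw [box, ht]
  simp only [hxx, Finset.sum_add_distrib, ← Finset.mul_sum, sum_coord_sq,
    normSq_eq_simVar_mul hz, e1, e2, e3]
  simp
  field_simp
  ring

end LeadingOrder

end ImplodingWave

namespace ImplodingWave

open Filter Topology

variable {d : ℕ}

section LeadingOrder

variable {k ℓ β : ℝ} {g : ℝ → ℝ} {φ ρ : Spacetime d → ℝ}

lemma IsReducedProfile.hasDerivAt_amplitude (hg : IsReducedProfile k ℓ β g) {w : ℝ} (hw : 0 < w) :
    HasDerivAt (amplitude β g)
      (amplitude β g w * ((β + 1) * g w / 2 + w * deriv g w) / (1 - w * g w)) w := by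
  have hq := (hg.one_sub_mul_pos w hw.le).ne'
  have h1 := ((hg.hasDerivAt_phaseIntegral hw.le).const_mul (β - 1)).exp
  have h2 := ((hasDerivAt_id w).mul (hg.hasDerivAt hw)).const_sub 1
  refine (h1.div h2 hq).congr_deriv ?_
  simp only [Pi.mul_apply, id_eq]
  have hq' : 1 - g w * w ≠ 0 := by rwa [mul_comm]
  rw [amplitude]
  field_simp
  ring

lemma IsReducedProfile.hasDerivAt_density (hg : IsReducedProfile k ℓ β g) (p : ℕ) {w A' : ℝ}
    (hw : 0 < w) (hA : HasDerivAt (amplitude β g) A' w) :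
    HasDerivAt (density p β g) (1 / ((p : ℝ) - 1) * density p β g w *
      (2 * A' / amplitude β g w -
        (g w ^ 2 + 2 * w * g w * deriv g w) / (1 - w * g w ^ 2))) w := by
  have hb := hg.density_base_pos hw.le
  have hm := (hg.one_sub_mul_sq_pos w hw.le).ne'
  have hA0 := (hg.amplitude_pos hw.le).ne'
  have h1 := (hA.pow 2).mul
    (((hasDerivAt_id w).mul ((hg.hasDerivAt hw).pow 2)).const_sub 1)
  refine (h1.rpow_const (p := 1 / ((p : ℝ) - 1)) (Or.inl hb.ne')).congr_deriv ?_
  simp only [Pi.mul_apply, Pi.pow_apply, id_eq]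
  rw [Real.rpow_sub_one hb.ne', ← density]
  field_simp
  ring

/-- The continuity equation at leading order. -/
lemma leading_order_J (hd : 0 < d) {p : ℕ} (hp : 3 ≤ p)
    (hg : IsReducedProfile ((d : ℝ) - 1) (ell p) β g) (hβ : 1 < β)
    (hφ : ∀ z ∈ past d, φ z = (1 - z.1) ^ (1 - β) * potential β g (simVar z))
    (hρ : ∀ z ∈ past d,
      ρ z = (1 - z.1) ^ (-(2 * β / ((p : ℝ) - 1))) * density p β g (simVar z)) :
    ∀ z ∈ past d, 2 * mink ρ φ z + ρ z * box φ z = 0 := by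
  have hSφ := isSymbol_selfSimilar hg.contDiffOn_potential hφ
  have hSρ := isSymbol_selfSimilar (hg.contDiffOn_density p) hρ
  refine eqOn_past_of_eqOn_ne_zero hd
    ((continuousOn_const.mul (hSρ.mink hSφ).1.continuousOn).add
      (hSρ.1.continuousOn.mul hSφ.box.1.continuousOn)) continuousOn_const fun z hz hx => ?_
  have hθ := one_sub_pos_of_mem_past hz
  have hw := simVar_pos hz hx
  have hp1 : (p : ℝ) - 1 ≠ 0 := by
    have : (3 : ℝ) ≤ p := by exact_mod_cast hp
    linarith
  have hA := hg.hasDerivAt_amplitude hw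
  have hD := hg.hasDerivAt_density p hw hA
  have hm := (hg.one_sub_mul_sq_pos _ hw.le).ne'
  have hq := (hg.one_sub_mul_pos _ hw.le).ne'
  have hA0 := (hg.amplitude_pos hw.le).ne'
  have hode := hg.ode _ hw
  have hρt : dt ρ z = _ := (fderiv_apply_congr_of_past hρ hz _).trans (dt_selfSimilar hz hD)
  have hρx : ∀ i, dx i ρ z = _ := fun i =>
    (fderiv_apply_congr_of_past hρ hz _).trans (dx_selfSimilar hz hD i)
  have e1 : ∀ a : ℝ, (1 - z.1) ^ (a - 1) = (1 - z.1) ^ a / (1 - z.1) :=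
    fun a => Real.rpow_sub_one hθ.ne' a
  have e2 : (1 - z.1) ^ (-1 - β) = (1 - z.1) ^ (-β) / (1 - z.1) := by rw [← e1]; ring_nf
  have e3 : ∀ a : ℝ, (1 - z.1) ^ (a - 2) = (1 - z.1) ^ a / (1 - z.1) ^ 2 := fun a => by
    rw [Real.rpow_sub hθ]; norm_num
  have hs := sum_coord_sq z.2
  rw [normSq_eq_simVar_mul hz] at hs
  rw [box_phiZero hg hβ hφ hz hA hx, mink, dt_phiZero hg hβ hφ hz, hρt, hρ z hz]
  simp only [dx_phiZero hg hβ hφ hz, hρx, e1, e2, e3]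
  generalize hP' : (1 / ((p : ℝ) - 1) * density p β g (simVar z) * _ : ℝ) = P'
  generalize hA' : (amplitude β g (simVar z) *
    ((β + 1) * g (simVar z) / 2 + simVar z * deriv g (simVar z)) / _ : ℝ) = A' at hP' ⊢
  have hsum : (∑ i, 2 * ((1 - z.1) ^ (-(2 * β / ((p : ℝ) - 1))) / (1 - z.1) ^ 2) * P' * z.2 i *
      ((1 - z.1) ^ (-β) / (1 - z.1) * (amplitude β g (simVar z) * g (simVar z)) * z.2 i)) =
      2 * ((1 - z.1) ^ (-(2 * β / ((p : ℝ) - 1))) / (1 - z.1) ^ 2) * P' *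
      ((1 - z.1) ^ (-β) / (1 - z.1) * (amplitude β g (simVar z) * g (simVar z))) *
        (simVar z * (1 - z.1) ^ 2) := by
    rw [← hs, Finset.mul_sum]
    exact Finset.sum_congr rfl fun i _ => by ring
  rw [hsum]
  set w := simVar z
  set θ := 1 - z.1
  set t₁ := θ ^ (-(2 * β / ((p : ℝ) - 1)))
  set t₂ := θ ^ (-β)
  set A := amplitude β g w
  set P := density p β g w
  set G := g w
  set G' := deriv g w
  -- The common power of 1 - t is removed. Inserting the formulas for P' and A', with ℓ = 1 +
  -- 4/(p-1) and k = d - 1, turns what remains into the profile equation times P A, up to nonzero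
  -- denominators.
  have key : 2 * ((-(2 * β / ((p : ℝ) - 1)) * P - 2 * w * P') * A + 2 * w * P' * (A * G)) +
      P * (-(β * A + 2 * w * A') + d * (A * G) + 2 * w * (A' * G + A * G')) = 0 := by
    rw [ell] at hode
    rw [← hP', ← hA']
    field_simp
    field_simp at hode
    linear_combination (P * A) * hode
  have : t₁ * t₂ / θ * (2 * ((-(2 * β / ((p : ℝ) - 1)) * P - 2 * w * P') * A +
      2 * w * P' * (A * G)) + P * (-(β * A + 2 * w * A') + d * (A * G) +
        2 * w * (A' * G + A * G'))) = 0 := by rw [key, mul_zero]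
  rw [← this]
  field_simp
  ring

end LeadingOrder

end ImplodingWave

/-! ### Lower bounds near the tip and selection of the time scales. -/

namespace ImplodingWave

open Filter Topology

variable {d : ℕ}

/-! ### Positivity at leading order -/

lemma normDx_eq_norm (f : Spacetime d → ℝ) (z : Spacetime d) :
    normDx f z = ‖WithLp.toLp 2 (fun i => dx i f z)‖ := by
  rw [EuclideanSpace.norm_eq]
  simp [normDx]

lemma normDx_add_le {f g : Spacetime d → ℝ} (hf : ContDiffOn ℝ ∞ f (past d))
    (hg : ContDiffOn ℝ ∞ g (past d)) {z : Spacetime d} (hz : z ∈ past d) :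
    normDx (f + g) z ≤ normDx f z + ∑ i, |dx i g z| := by
  have h1 : normDx (f + g) z ≤ normDx f z + normDx g z := by
    simp only [normDx_eq_norm, dx_add hf hg _ hz]
    exact norm_add_le (WithLp.toLp 2 fun i => dx i f z) (WithLp.toLp 2 fun i => dx i g z)
  have h2 : normDx g z ≤ ∑ i, |dx i g z| := by
    refine Real.sqrt_le_iff.2 ⟨Finset.sum_nonneg fun _ _ => abs_nonneg _, ?_⟩
    simp only [← sq_abs (dx _ g z)]
    exact Finset.sum_sq_le_sq_sum_of_nonneg fun _ _ => abs_nonneg _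
  linarith

lemma IsSymbol.abs_le {a : ℝ} {f : Spacetime d → ℝ} (hf : IsSymbol a f) :
    ∃ C, 0 ≤ C ∧ ∀ z ∈ cone d, |f z| ≤ C * (1 - z.1) ^ a := by
  obtain ⟨C, hC⟩ := hf.2 0
  refine ⟨|C|, abs_nonneg C, fun z hz => ?_⟩
  have hp := one_sub_pos_of_mem_cone hz
  have := hC z hz
  rw [norm_iteratedFDeriv_zero, Real.norm_eq_abs, Nat.cast_zero, sub_zero] at this
  exact this.trans (by gcongr; exact le_abs_self C)

section LeadingOrder

variable {k ℓ β : ℝ} {g : ℝ → ℝ} {φ : Spacetime d → ℝ}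

lemma normDx_phiZero (hg : IsReducedProfile k ℓ β g) (hβ : 1 < β)
    (hφ : ∀ z ∈ past d, φ z = (1 - z.1) ^ (1 - β) * potential β g (simVar z))
    {z : Spacetime d} (hz : z ∈ past d) :
    normDx φ z = (1 - z.1) ^ (-β) *
      (amplitude β g (simVar z) * (√(simVar z) * |g (simVar z)|)) := by
  have hθ := one_sub_pos_of_mem_past hz
  have hA := hg.amplitude_pos (simVar_nonneg z)
  have e : (1 - z.1) ^ (-1 - β) = (1 - z.1) ^ (-β) / (1 - z.1) := by
    rw [← Real.rpow_sub_one hθ.ne']; ring_nf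
  have hn : ‖z.2‖ = √(simVar z) * (1 - z.1) := by
    rw [← Real.sqrt_sq (norm_nonneg z.2), normSq_eq_simVar_mul hz,
      Real.sqrt_mul (simVar_nonneg z), Real.sqrt_sq hθ.le]
  simp only [normDx, dx_phiZero hg hβ hφ hz, mul_pow _ (z.2 _), ← Finset.mul_sum, sum_coord_sq]
  rw [← mul_pow, Real.sqrt_sq_eq_abs, abs_mul, abs_mul, abs_mul, abs_of_pos hA, abs_norm, hn, e,
    abs_of_pos (by positivity)]
  field_simp

lemma simVar_mem_Icc {z : Spacetime d} (hz : z ∈ cone d) : simVar z ∈ Icc (0 : ℝ) 4 := by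
  have hp := one_sub_pos_of_mem_cone hz
  refine ⟨simVar_nonneg z, ?_⟩
  rw [simVar, div_le_iff₀ (by positivity)]
  nlinarith [norm_nonneg z.2, hz.2.2]

lemma exists_pos_le_of_continuousOn {f : ℝ → ℝ} (hf : ContinuousOn f (Ici 0))
    (hpos : ∀ w, 0 ≤ w → 0 < f w) : ∃ c, 0 < c ∧ ∀ w ∈ Icc (0 : ℝ) 4, c ≤ f w := by
  obtain ⟨w, hw, hmin⟩ := isCompact_Icc.exists_isMinOn (nonempty_Icc.2 (by norm_num : (0 : ℝ) ≤ 4))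
    (hf.mono Icc_subset_Ici_self)
  exact ⟨f w, hpos w hw.1, fun y hy => hmin hy⟩

/-- The rescaled quantity equals A(w)(1 - √w |g(w)|), where √w |g| = |v| < 1. It is continuous and
positive, and w stays in the compact interval [0, 4] on the cone. -/
lemma exists_lower_bound_phiZero (hg : IsReducedProfile k ℓ β g) (hβ : 1 < β)
    (hφ : ∀ z ∈ past d, φ z = (1 - z.1) ^ (1 - β) * potential β g (simVar z)) :
    ∃ c, 0 < c ∧ ∀ z ∈ cone d, c ≤ (1 - z.1) ^ β * (dt φ z - normDx φ z) := by
  obtain ⟨c, hc, hcb⟩ := exists_pos_le_of_continuousOn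
    (f := fun w => amplitude β g w * (1 - √w * |g w|))
    (hg.contDiffOn_amplitude.continuousOn.mul (continuousOn_const.sub
      (Real.continuous_sqrt.continuousOn.mul hg.smooth.continuousOn.abs))) fun w hw => by
    refine mul_pos (hg.amplitude_pos hw) (sub_pos.2 ?_)
    have h1 := hg.one_sub_mul_sq_pos w hw
    have h2 : (√w * |g w|) ^ 2 < 1 := by
      rw [mul_pow, Real.sq_sqrt hw, sq_abs]; linarith
    exact (sq_lt_one_iff₀ (by positivity)).1 h2
  refine ⟨c, hc, fun z hz => (hcb _ (simVar_mem_Icc hz)).trans_eq ?_⟩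
  have hz' := cone_subset_past hz
  have hθ := one_sub_pos_of_mem_past hz'
  have e : (1 - z.1) ^ β * (1 - z.1) ^ (-β) = 1 := by rw [← Real.rpow_add hθ]; simp
  rw [dt_phiZero hg hβ hφ hz', normDx_phiZero hg hβ hφ hz']
  linear_combination (-(amplitude β g (simVar z) * (1 - √(simVar z) * |g (simVar z)|))) * e

end LeadingOrder

/-- Lower bounds on a leading order term persist under perturbations of higher order. -/
lemma exists_lower_bound_of_isSymbol_sub {β r δ c₁ c₂ : ℝ} (hδ : 0 < δ) (hc₁ : 0 < c₁)
    (hc₂ : 0 < c₂) {φ₀ ρ₀ φ ρ : Spacetime d → ℝ} (hφ₀ : ContDiffOn ℝ ∞ φ₀ (past d))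
    (h₁ : ∀ z ∈ cone d, c₁ ≤ (1 - z.1) ^ β * (dt φ₀ z - normDx φ₀ z))
    (h₂ : ∀ z ∈ cone d, c₂ ≤ (1 - z.1) ^ r * ρ₀ z)
    (hφ : IsSymbol (1 - β + δ) (φ - φ₀)) (hρ : IsSymbol (-r + δ) (ρ - ρ₀)) :
    ∃ c, 0 < c ∧ c < 1 ∧ ∀ z ∈ cone d, 1 - z.1 < c →
      c ≤ (1 - z.1) ^ β * (dt φ z - normDx φ z) ∧ c ≤ (1 - z.1) ^ r * ρ z := by
  obtain ⟨C₁, hC₁, hb₁⟩ := hφ.dt.abs_le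
  choose C₂ hC₂ hb₂ using fun i => (hφ.dx i).abs_le
  obtain ⟨C₃, hC₃, hb₃⟩ := hρ.abs_le
  set M := C₁ + ∑ i, C₂ i + C₃
  have hS : 0 ≤ ∑ i, C₂ i := Finset.sum_nonneg fun i _ => hC₂ i
  -- The same c is both the distance to the tip and the lower bound, so it must satisfy c + M c^δ <
  -- min c₁ c₂, where M c^δ dominates the perturbation.
  have hlim : Tendsto (fun s : ℝ => s + M * s ^ δ) (𝓝[>] 0) (𝓝 0) := by
    have h1 : ContinuousAt (fun s : ℝ => s + M * s ^ δ) 0 :=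
      continuousAt_id.add (continuousAt_const.mul (Real.continuousAt_rpow_const 0 δ (Or.inr hδ.le)))
    have h2 := h1.tendsto
    simp only [Real.zero_rpow hδ.ne', mul_zero, add_zero] at h2
    exact h2.mono_left nhdsWithin_le_nhds
  have hev := (hlim.eventually_lt_const (lt_min hc₁ hc₂)).and
    (((gt_mem_nhds one_pos).filter_mono nhdsWithin_le_nhds).and self_mem_nhdsWithin)
  obtain ⟨c, hcM, hc1, hc0⟩ := hev.exists
  have hc0 : 0 < c := hc0
  refine ⟨c, hc0, hc1, fun z hz hzc => ?_⟩
  have hz' := cone_subset_past hz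
  have hθ := one_sub_pos_of_mem_past hz'
  have hpow : (1 - z.1) ^ δ ≤ c ^ δ := by gcongr
  have hMle : ∀ C, 0 ≤ C → C ≤ M → C * (1 - z.1) ^ δ ≤ M * c ^ δ := fun C hC hCM =>
    mul_le_mul hCM hpow (by positivity) (hC.trans hCM)
  have hmin₁ := min_le_left c₁ c₂
  have hmin₂ := min_le_right c₁ c₂
  have eβ : ∀ x : ℝ, x * (1 - z.1) ^ (1 - β + δ - 1) * (1 - z.1) ^ β = x * (1 - z.1) ^ δ := by
    intro x; rw [mul_assoc, ← Real.rpow_add hθ]; ring_nf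
  have er : (1 - z.1) ^ (-r + δ) * (1 - z.1) ^ r = (1 - z.1) ^ δ := by
    rw [← Real.rpow_add hθ]; ring_nf
  constructor
  · have hW := hφ.1
    have e : φ = φ₀ + (φ - φ₀) := by abel
    have hd1 : dt φ z = dt φ₀ z + dt (φ - φ₀) z := by
      conv_lhs => rw [e]
      exact dt_add hφ₀ hW hz'
    have hd2 : normDx φ z ≤ normDx φ₀ z + ∑ i, |dx i (φ - φ₀) z| := by
      conv_lhs => rw [e]
      exact normDx_add_le hφ₀ hW hz'
    have h3 : ∑ i, |dx i (φ - φ₀) z| ≤ (∑ i, C₂ i) * (1 - z.1) ^ (1 - β + δ - 1) := by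
      rw [Finset.sum_mul]
      exact Finset.sum_le_sum fun i _ => hb₂ i z hz
    have h4 := (abs_le.1 (hb₁ z hz)).1
    have h5 : dt φ₀ z - normDx φ₀ z - (C₁ + ∑ i, C₂ i) * (1 - z.1) ^ (1 - β + δ - 1) ≤
        dt φ z - normDx φ z := by linarith
    have h6 := mul_le_mul_of_nonneg_left h5 (Real.rpow_nonneg hθ.le β)
    rw [mul_sub, mul_comm _ ((C₁ + _) * _), eβ] at h6
    have h7 := hMle (C₁ + ∑ i, C₂ i) (by positivity) (le_add_of_nonneg_right hC₃)
    linarith [h₁ z hz]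
  · have h4 := (abs_le.1 (hb₃ z hz)).1
    rw [Pi.sub_apply] at h4
    have h5 : ρ₀ z - C₃ * (1 - z.1) ^ (-r + δ) ≤ ρ z := by linarith
    have h6 := mul_le_mul_of_nonneg_left h5 (Real.rpow_nonneg hθ.le r)
    rw [mul_sub, mul_comm _ (C₃ * _), mul_assoc, er] at h6
    have h7 := hMle C₃ hC₃ (le_add_of_nonneg_left (by positivity))
    linarith [h₂ z hz]

/-! ### The choice of the time scales -/

/-- The threshold is imposed from index 1 on only: T 0 = 1 is prescribed, and the leading term never
appears in a remainder. -/
lemma exists_timeScales {τ : ℕ → ℝ} (hτ : ∀ n, 0 < τ n) :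
    ∃ T : ℕ → ℝ, T 0 = 1 ∧ (∀ n, 0 < T n) ∧ (∀ n, T (n + 1) ≤ T n / 4) ∧
      ∀ n, T (n + 1) ≤ τ (n + 1) := by
  set T : ℕ → ℝ := fun n => Nat.rec 1 (fun n t => min (t / 4) (τ (n + 1))) n
  have hs : ∀ n, T (n + 1) = min (T n / 4) (τ (n + 1)) := fun n => rfl
  refine ⟨T, rfl, fun n => ?_, fun n => (hs n).trans_le (min_le_left _ _),
    fun n => (hs n).trans_le (min_le_right _ _)⟩
  induction n with
  | zero => exact one_pos
  | succ n ih => rw [hs]; exact lt_min (by positivity) (hτ _)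

end ImplodingWave

/-! ### Assembly of the theorem. -/

open ImplodingWave
theorem mainTheorem5 (d p : ℕ) (hd : 4 ≤ d) (hp : Odd p) (hp3 : 3 ≤ p)
    (β : ℝ) (hβ : 1 < β) (hk : β * (ell p + √(ell p)) < (d : ℝ) - 1)
    (v : ℝ → ℝ) (hv : IsProfile ((d : ℝ) - 1) (ell p) β v)
    (ρ φ : ℕ → Spacetime d → ℝ) (hρφ : IsFormalSolution p β v ρ φ)
    (η : ℝ → ℝ) (hη : IsBump η) :
    ∃ (N₀ : ℕ) (c₀ : ℝ) (T : ℕ → ℝ),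
      1 ≤ N₀ ∧ 0 < c₀ ∧ c₀ < 1 ∧
      (∀ n, n < N₀ → T n = 1) ∧ (∀ n, N₀ ≤ n → 0 < T n ∧ T n ≤ T (n - 1) / 4) ∧
      -- the series are finite sums and define smooth functions
      (∀ t : ℝ, t < 1 → {n : ℕ | η ((1 - t) / T n) ≠ 0}.Finite) ∧
      ContDiffOn ℝ ∞ (truncSum η T ρ) {z | z.1 < 1} ∧
      ContDiffOn ℝ ∞ (truncSum η T φ) {z | z.1 < 1} ∧
      -- self-similar derivative bounds
      (∀ j : ℕ, WeightedBdd (β + j - 1) j (truncSum η T φ) ∧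
        WeightedBdd (2 * β / ((p : ℝ) - 1) + j) j (truncSum η T ρ)) ∧
      -- positivity near the tip of the cone
      (∀ z ∈ cone d, 1 - z.1 < c₀ →
        c₀ ≤ (1 - z.1) ^ β * (dt (truncSum η T φ) z - normDx (truncSum η T φ) z) ∧
        c₀ ≤ (1 - z.1) ^ (2 * β / ((p : ℝ) - 1)) * truncSum η T ρ z) ∧
      -- the errors vanish to infinite order at the tip, with all derivatives
      (∀ lam : ℝ, 0 < lam → ∀ j : ℕ,
        WeightedBdd (-lam) j (errE p (truncSum η T ρ) (truncSum η T φ)) ∧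
        WeightedBdd (-lam) j (errJ (truncSum η T ρ) (truncSum η T φ))) := by
  have hδ : 0 < β - 1 := sub_pos.2 hβ
  have hℓ : 0 < ell p := by
    have : (3 : ℝ) ≤ p := by exact_mod_cast hp3
    have : (0 : ℝ) < (p : ℝ) - 1 := by linarith
    unfold ell; positivity
  obtain ⟨g, hg, hvg⟩ := hv.exists_reduced hℓ hβ
  obtain ⟨h0, hrec⟩ := hρφ
  have hφ0 : ∀ z ∈ past d, φ 0 z = (1 - z.1) ^ (1 - β) * potential β g (simVar z) :=
    fun z hz => (h0 z hz).2.trans (phiZero_eq hg hvg hz)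
  have hρ0 : ∀ z ∈ past d, ρ 0 z =
      (1 - z.1) ^ (-(2 * β / ((p : ℝ) - 1))) * density p β g (simVar z) :=
    fun z hz => (h0 z hz).1.trans (rhoZero_eq hg hβ hvg p hz)
  set r : ℝ := 2 * β / ((p : ℝ) - 1)
  -- The exponent λ_n equals 1 - β + 2n(β-1). Only half of the gain is kept for n ≥ 1; the other
  -- half absorbs the logarithms. The same is done for ρ_n.
  have hφS : ∀ n : ℕ, IsSymbol (1 - β + n * (β - 1)) (φ n) := fun n => by
    rcases Nat.eq_zero_or_pos n with rfl | hn
    · simpa using isSymbol_selfSimilar hg.contDiffOn_potential hφ0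
    · refine isSymbol_of_mem_spaceX ?_ (hrec n hn).2.1
      have : 0 < (n : ℝ) * (β - 1) := by positivity
      rw [lamExp]; linarith
  have hρS : ∀ n : ℕ, IsSymbol (-r + n * (β - 1)) (ρ n) := fun n => by
    rcases Nat.eq_zero_or_pos n with rfl | hn
    · simpa using isSymbol_selfSimilar (hg.contDiffOn_density p) hρ0
    · refine isSymbol_of_mem_spaceX ?_ (hrec n hn).1
      have : 0 < (n : ℝ) * (β - 1) := by positivity
      rw [muExp]; linarith
  choose τφ hτφ0 hτφ using fun n => (hφS n).exists_threshold hη hδ n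
  choose τρ hτρ0 hτρ using fun n => (hρS n).exists_threshold hη hδ n
  obtain ⟨T, hT1, hT0, hT4, hTτ⟩ := exists_timeScales fun n => lt_min (hτφ0 n) (hτρ0 n)
  have hTpow : ∀ n, T n ≤ (1 / 4) ^ n := fun n => by
    induction n with
    | zero => simp [hT1]
    | succ n ih => rw [pow_succ]; linarith [hT4 n]
  have hanti : Antitone T := antitone_nat_of_succ_le fun n => by linarith [hT4 n, hT0 n]
  have hτ : ∀ n, 1 ≤ n → T n ≤ min (τφ n) (τρ n) := fun n hn => by
    obtain ⟨n, rfl⟩ := Nat.exists_eq_add_of_le' hn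
    exact hTτ n
  have hφR := isSymbol_truncSum_sub hη hT0 hTpow hanti hδ.le hφS fun n hn =>
    hτφ n (T n) (hT0 n) ((hτ n hn).trans (min_le_left _ _))
  have hρR := isSymbol_truncSum_sub hη hT0 hTpow hanti hδ.le hρS fun n hn =>
    hτρ n (T n) (hT0 n) ((hτ n hn).trans (min_le_right _ _))
  -- The remainder estimate with N = 0 has no gain over the order a, so the gain β - 1 comes from N
  -- = 1, with f 1 added back.
  have hsub : ∀ {a : ℝ} {f : ℕ → Spacetime d → ℝ}, (∀ n : ℕ, IsSymbol (a + n * (β - 1)) (f n)) →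
      (∀ N : ℕ, IsSymbol (a + N * (β - 1)) (truncSum η T f - ∑ n ∈ Finset.range (N + 1), f n)) →
      IsSymbol (a + (β - 1)) (truncSum η T f - f 0) := fun {a f} hf hR => by
    have h1 := (hR 1).add (hf 1)
    rw [Nat.cast_one, one_mul] at h1
    refine h1.congr fun z _ => ?_
    simp only [Finset.sum_range_succ, Finset.range_one, Finset.sum_singleton, Pi.sub_apply,
      Pi.add_apply]
    ring
  have hφD := hsub hφS hφR
  have hρD := hsub hρS hρR
  have hφ0S : IsSymbol (1 - β) (φ 0) := by simpa using hφS 0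
  have hρ0S : IsSymbol (-r) (ρ 0) := by simpa using hρS 0
  have hφT : IsSymbol (1 - β) (truncSum η T φ) := by
    simpa using (hφD.mono (b := 1 - β) (by linarith)).add hφ0S
  have hρT : IsSymbol (-r) (truncSum η T ρ) := by
    simpa using (hρD.mono (b := -r) (by linarith)).add hρ0S
  obtain ⟨c₁, hc₁, hb₁⟩ := exists_lower_bound_phiZero hg hβ hφ0
  obtain ⟨c₂, hc₂, hb₂⟩ := exists_pos_le_of_continuousOn (hg.contDiffOn_density p).continuousOn
    fun w hw => hg.density_pos p hw
  obtain ⟨c₀, hc₀, hc₀1, hpos⟩ := exists_lower_bound_of_isSymbol_sub hδ hc₁ hc₂ hφ0S.1 hb₁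
    (r := r) (ρ₀ := ρ 0) (fun z hz => by
      have hz' := cone_subset_past hz
      rw [hρ0 z hz', ← mul_assoc, ← Real.rpow_add (one_sub_pos_of_mem_past hz'), add_neg_cancel,
        Real.rpow_zero, one_mul]
      exact hb₂ _ (simVar_mem_Icc hz)) hφD hρD
  have herr := isSymbol_err_of_asymptotic hδ hρS hφS
    (fun z hz => leading_order_E hg hβ hp3 hφ0 hρ0 hz)
    (leading_order_J (by omega) hp3 hg hβ hφ0 hρ0) (fun n hn => (hrec n hn).2.2) hρR hφR
  -- N₀ = 1 suffices because every term after the leading one may be truncated. For the errors,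
  -- order λ + j compensates both the weight (1-t)^{-λ} and the j derivatives.
  refine ⟨1, c₀, T, le_rfl, hc₀, hc₀1, fun n hn => ?_, fun n hn => ⟨hT0 n, ?_⟩,
    fun t ht => finite_setOf_bump_ne_zero hη hT0 hTpow ht, hρT.1, hφT.1,
    fun j => ⟨hφT.weightedBdd (by linarith), hρT.weightedBdd (by linarith)⟩, hpos,
    fun lam _ j => ⟨(herr (lam + j)).1.weightedBdd (by linarith),
      (herr (lam + j)).2.weightedBdd (by linarith)⟩⟩
  · rw [Nat.lt_one_iff.1 hn, hT1]
  · obtain ⟨n, rfl⟩ := Nat.exists_eq_add_of_le' hn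
    exact hT4 n
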